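/- **Setting.** Let $H$ be a finite, connected, simple graph and let $\pi\colon T\to H$ be its universal cover, i.e. $T$ is a tree and $\pi$ maps the neighbours of each $v\in V(T)$ bijectively onto the neighbours of $\pi(v)$. Let $M$ be a bounded operator on $\ell^2(V(T))$ with entries $M_{uv}=\langle\delta_u,M\delta_v\rangle$ that is * *symmetric*: $\overline{M}^{\,*}=M$; * *local*: $M_{uv}=0$ if $u,v$ are at distance greater than one; * a *pullback from $H$*: there are numbers $m_{ab}$ ($a,b\in V(H)$) with $M_{uv}=m_{\pi(u)\pi(v)}$ whenever $u=v$ or $u\sim v$. Let $H_M$ be the graph on $V(H)$ whose edges are the edges $\{a,b\}$ of $H$ with $m_{ab}\neq 0$ (so $H_M=H$ if no $m_{ab}$ with $a\sim b$ vanishes), and let $E$ be the set of its directed edges. For $e=(a,b)\in E$ put $m_e=m_{ab}$ and $e^{-1}=(b,a)$; write $e\to f$ if the head of $e$ is the tail of $f$ and $f\ne e^{-1}$. A *ratio system* for $M$ is a function $r\colon E\to\mathbb{C}\cup\{\infty\}$ such that 1. if $r_e\neq 0$ and $e=(a,b)$, then $0=m_{bb}+\dfrac{m_{e^{-1}}}{r_e}+\sum_{f:\,e\to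 f}m_f r_f$, where $c/\infty=0$; 2. if $r_e=0$, then there is $f$ with $e\to f$ and $r_f=\infty$; 3. if $r_f=\infty$ and $e\to f$, then $r_e=0$ and $r_{f^{-1}}\neq 0$. Its *decay rate* $\alpha(r)$ is the Perron eigenvalue (spectral radius) of the nonnegative matrix $R$ indexed by the $e\in E$ with $r_e\neq0$ (infinite ratios included), where $$R_{e,f}=\begin{cases}\sum_{e':\,e\to e'\to f}\left|m_{e'^{-1}}/m_f\right|^2 & \text{if } r_f=\infty,\\ |r_f|^2 & \text{if } r_f\ne\infty\text{ and } e\to f,\\ 0&\text{otherwise,}\end{cases}$$ and $\alpha(r)=0$ if this matrix is empty. **Theorem.** (i) If $M$ has a bounded inverse, then $M$ has a ratio system $r$ with $\alpha(r)<1$. (ii) Conversely, suppose that every connected component of $H_M$ contains a cycle. If $M$ has a ratio system $r$ with $\alpha(r)<1$, then $M$ has a bounded inverse. Hence, under this assumption, $M$ has a bounded inverse if and only if it has a ratio system $r$ with $\alpha(r)<1$. (iii) Suppose that $M$ has a bounded inverse, let $G(u,v)=\langle\delta_u,M^{-1}\delta_v\rangle$ be its Green function, and let $r$ be any ratio system for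 $M$ with $\alpha(r)<1$. Then for every directed edge $(u,v)$ of $T$ whose image $e=(\pi(u),\pi(v))$ lies in $E$, and every $w\in V(T)$ such that $u$ lies on the path $[w,v]$, $$\frac{G(w,v)}{G(w,u)}=r_e$$ whenever $G(w,u)$ and $G(w,v)$ are not both zero, the quotient being read as $\infty$ if $G(w,u)=0$. -/

import Mathlib

open scoped ENNReal

namespace TreeOperator

noncomputable section

/-! ### Universal covers and operators on `ℓ²(V(T))` -/

/-- `π : T → H` is the universal cover of the connected graph `H`: the graph `T` is a tree, and
`π` maps the neighbours of every vertex `v` of `T` bijectively onto the neighbours of `π v`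
(for simple graphs this says that `π` is a graph homomorphism which is a bijection between the
edges at `v` and the edges at `π v`). -/
structure IsUniversalCover {VH VT : Type*} (H : SimpleGraph VH) (T : SimpleGraph VT)
    (π : VT → VH) : Prop where
  isTree : T.IsTree
  bijOn : ∀ v : VT, Set.BijOn π (T.neighborSet v) (H.neighborSet (π v))

/-- The Hilbert space `ℓ²(V)`. -/
abbrev L2 (V : Type*) : Type _ := lp (fun _ : V => ℂ) 2

open Classical in
/-- The Dirac function at `v`. -/
def delta {V : Type*} (v : V) : L2 V := lp.single 2 v (1 : ℂ)

/-- The matrix entry `A_{uv} = ⟨δ_u, A δ_v⟩`. -/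
def entry {V : Type*} (A : L2 V →L[ℂ] L2 V) (u v : V) : ℂ :=
  inner ℂ (delta u) (A (delta v))

/-- Real symmetry: the adjoint of `M` is its complex conjugate `f ↦ conj (M (conj f))`. -/
def IsSymmetric {V : Type*} (M : L2 V →L[ℂ] L2 V) : Prop :=
  ∀ f : L2 V, ContinuousLinearMap.adjoint M f = star (M (star f))

/-- `M` is local: its entries vanish at pairs of vertices of distance greater than one. -/
def IsLocal {V : Type*} (T : SimpleGraph V) (M : L2 V →L[ℂ] L2 V) : Prop :=
  ∀ u v : V, 1 < T.dist u v → entry M u v = 0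

/-- `M` is pulled back along `π`: the entries `M_{uv}` on the diagonal and on the edges of `T`
are functions `m` of `(π u, π v)`.  (The other values of `m` play no role.) -/
def IsPullback {VH VT : Type*} (T : SimpleGraph VT) (π : VT → VH)
    (M : L2 VT →L[ℂ] L2 VT) (m : VH → VH → ℂ) : Prop :=
  ∀ u v : VT, (u = v ∨ T.Adj u v) → entry M u v = m (π u) (π v)

/-- The Green function `G(u, v) = ⟨δ_u, M⁻¹ δ_v⟩`; it is used only for invertible `M`. -/
def green {V : Type*} (M : L2 V →L[ℂ] L2 V) (u v : V) : ℂ :=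
  entry (Ring.inverse M) u v

/-- The graph `H_M`: the edges of `H` on which the coefficient of `M` is nonzero.  (For a
symmetric `M` the two conditions on `m` coincide.) -/
def supportGraph {VH : Type*} (H : SimpleGraph VH) (m : VH → VH → ℂ) : SimpleGraph VH where
  Adj a b := H.Adj a b ∧ m a b ≠ 0 ∧ m b a ≠ 0
  symm := ⟨fun _ _ h => ⟨h.1.symm, h.2.2, h.2.1⟩⟩
  loopless := ⟨fun _ h => h.1.ne rfl⟩

/-- `u` lies on the path `[w, v]` of the tree `T`. -/
def OnPath {V : Type*} (T : SimpleGraph V) (w u v : V) : Prop :=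
  ∃ p : T.Walk w v, p.IsPath ∧ u ∈ p.support

/-! ### Generalized ratios and ratio systems -/

/-- The generalized ratio `b / a` in `ℂ ∪ {∞}`, meaningful if `a` and `b` do not both vanish. -/
def genRatio (b a : ℂ) : OnePoint ℂ :=
  open Classical in if a = 0 then OnePoint.infty else ((b / a : ℂ) : OnePoint ℂ)

/-- `c / r` for `r ∈ ℂ ∪ {∞}`, with `c / ∞ = 0`. -/
def divRatio (c : ℂ) (r : OnePoint ℂ) : ℂ := r.elim 0 (fun z => c / z)

/-- The finite value of `r ∈ ℂ ∪ {∞}` (by convention `0` for `r = ∞`). -/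
def finVal (r : OnePoint ℂ) : ℂ := r.elim 0 (fun z => z)

/-- `e → f`: the head of `e` is the tail of `f`, and `f` is not the reverse of `e`. -/
def Follows {V : Type*} {X : SimpleGraph V} (e f : X.Dart) : Prop :=
  e.snd = f.fst ∧ f ≠ e.symm

open Classical in
/-- Ratio systems on the directed edges of the finite graph `X` (a directed edge `(u, v)` is a
`Dart` with `fst = u` and `snd = v`) for the coefficients `m`.  The sum in `recursion` has only
finite ratios in it: `r f = ∞` and `e → f` force `r e = 0` by `eq_zero_of_top`. -/
structure IsRatioSystem {V : Type*} [Fintype V] (X : SimpleGraph V) (m : V → V → ℂ)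
    (r : X.Dart → OnePoint ℂ) : Prop where
  recursion : ∀ e : X.Dart, r e ≠ ((0 : ℂ) : OnePoint ℂ) →
    0 = m e.snd e.snd + divRatio (m e.snd e.fst) (r e)
      + ∑ f : X.Dart with Follows e f, m f.fst f.snd * finVal (r f)
  exists_top : ∀ e : X.Dart, r e = ((0 : ℂ) : OnePoint ℂ) →
    ∃ f : X.Dart, Follows e f ∧ r f = OnePoint.infty
  eq_zero_of_top : ∀ e f : X.Dart, r f = OnePoint.infty → Follows e f →
    r e = ((0 : ℂ) : OnePoint ℂ)
  symm_ne_zero_of_top : ∀ e f : X.Dart, r f = OnePoint.infty → Follows e f →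
    r f.symm ≠ ((0 : ℂ) : OnePoint ℂ)

open Classical in
/-- The matrix `R`, indexed by the directed edges with nonzero (possibly infinite) ratio. -/
def decayMatrix {V : Type*} [Fintype V] (X : SimpleGraph V) (m : V → V → ℂ)
    (r : X.Dart → OnePoint ℂ) :
    Matrix {e : X.Dart // r e ≠ ((0 : ℂ) : OnePoint ℂ)}
      {e : X.Dart // r e ≠ ((0 : ℂ) : OnePoint ℂ)} ℝ :=
  fun e f =>
    if r f.1 = OnePoint.infty then
      ∑ g : X.Dart with Follows e.1 g ∧ Follows g f.1,
        ‖m g.snd g.fst / m f.1.fst f.1.snd‖ ^ 2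
    else if Follows e.1 f.1 then ‖finVal (r f.1)‖ ^ 2
    else 0

open Classical in
/-- The decay rate `α(r)`: the Perron eigenvalue of the nonnegative matrix `R`, that is, its
spectral radius (which is `0` if there are no directed edges). -/
def decayRate {V : Type*} [Fintype V] (X : SimpleGraph V) (m : V → V → ℂ)
    (r : X.Dart → OnePoint ℂ) : ℝ≥0∞ :=
  spectralRadius ℂ ((decayMatrix X m r).map (fun x : ℝ => (x : ℂ)))

end

end TreeOperator

/-! Both directions rest on one fact about the nonnegative matrix `R`: its spectral radius is less
than one exactly when some weight `p ≥ 1` satisfies `1 + R p ≤ p`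
(`exists_weight_of_spectralRadius_lt_one`, `spectralRadius_lt_one_of_weight`).

From an inverse to ratios: a row `G(w, ·)` of the Green function solves `M φ = 0` away from `w`.
Across an edge `uv` the rows with source on the side of `u` are proportional (`greenRow_mul_comm`):
a combination vanishing at `u` can be cut off there, and the cut function is a multiple of `G(u,
·)`. By deck transformations the quotients depend only on the edge of `H` (`exists_isGreenRatio`),
and the equation at each vertex yields most of the conditions on ratios. The squared norm of a row
beyond `(u, v)`, divided by `|G(w, v)|²`, provides the weight, since the parts of the tree beyond
the different children are disjoint.

From ratios to estimates: orient the lifted edges from parent to child, and let the residual of `φ`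
at `v` measure how far `φ` is from having the prescribed ratio on the edge into `v`. The equation `M
φ = h` at `v`, minus `φ v` times the recursion, expresses the residual at `v` through `h v` and the
residuals at its children. The weight makes this a contraction, so `h` bounds the residuals
(`sqBound_residual`). A zero ratio into a vertex forces an infinite one out of it; such vertices are
skipped, which is why `R` has entries spanning two edges.

With the tree rooted at `w` and `φ = G(w, ·)`, the function `h` vanishes off the root, hence so do
all residuals; this is (iii). For (ii), cycles allow an orientation in which every vertex has a
parent (`exists_orientation_univ`). Then `φ` is recovered from its residuals by the transposed
recursion, from parents to children, which contracts for the same weight (`sqBound_of_eq`). So `‖φ‖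
≤ C ‖M φ‖`, and symmetry gives invertibility. Some such assumption is needed: a single vertex with
`M = 0` has the empty ratio system. -/

namespace TreeOperator

/-! ### Square-summable real families -/

section SquareSums

variable {V : Type*}

/-- The family `F` is square summable with sum of squares at most `C`. -/
def SqBound (F : V → ℝ) (C : ℝ) : Prop :=
  Summable (fun x => F x ^ 2) ∧ ∑' x, F x ^ 2 ≤ C

lemma sqBound_of_sum_le {F : V → ℝ} {C : ℝ} (h : ∀ s : Finset V, ∑ x ∈ s, F x ^ 2 ≤ C) :
    SqBound F C := by
  have hs : Summable (fun x => F x ^ 2) := summable_of_sum_le (fun _ => sq_nonneg _) h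
  exact ⟨hs, hs.tsum_le_of_sum_le h⟩

lemma SqBound.sum_le {F : V → ℝ} {C : ℝ} (h : SqBound F C) (s : Finset V) :
    ∑ x ∈ s, F x ^ 2 ≤ C :=
  (h.1.sum_le_tsum s (fun _ _ => sq_nonneg _)).trans h.2

lemma SqBound.nonneg {F : V → ℝ} {C : ℝ} (h : SqBound F C) : 0 ≤ C := by
  simpa using h.sum_le ∅

lemma SqBound.mono {F G : V → ℝ} {C : ℝ} (h : SqBound F C) (hG : ∀ x, |G x| ≤ |F x|) :
    SqBound G C :=
  sqBound_of_sum_le fun s =>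
    (Finset.sum_le_sum fun x _ => sq_le_sq.2 (hG x)).trans (h.sum_le s)

lemma SqBound.mul_left {F : V → ℝ} {C : ℝ} (h : SqBound F C) (a : ℝ) :
    SqBound (fun x => a * F x) (a ^ 2 * C) := by
  refine sqBound_of_sum_le fun s => ?_
  simp only [mul_pow]
  rw [← Finset.mul_sum]
  exact mul_le_mul_of_nonneg_left (h.sum_le s) (sq_nonneg a)

lemma SqBound.add {F G : V → ℝ} {C D : ℝ} (hF : SqBound F C) (hG : SqBound G D) :
    SqBound (fun x => F x + G x) (2 * C + 2 * D) := by
  refine sqBound_of_sum_le fun s => ?_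
  calc ∑ x ∈ s, (F x + G x) ^ 2 ≤ ∑ x ∈ s, (2 * F x ^ 2 + 2 * G x ^ 2) :=
        Finset.sum_le_sum fun x _ => by nlinarith [sq_nonneg (F x - G x)]
    _ = 2 * ∑ x ∈ s, F x ^ 2 + 2 * ∑ x ∈ s, G x ^ 2 := by
        rw [Finset.sum_add_distrib, Finset.mul_sum, Finset.mul_sum]
    _ ≤ _ := by linarith [hF.sum_le s, hG.sum_le s]

/-- Sums over the neighbours of a locally finite symmetric relation of bounded degree. -/
lemma SqBound.sum_nbrs {F : V → ℝ} {C K : ℝ} (nb : V → Finset V)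
    (hsymm : ∀ x y, y ∈ nb x → x ∈ nb y) (hcard : ∀ x, ((nb x).card : ℝ) ≤ K)
    (h : SqBound F C) : SqBound (fun x => ∑ y ∈ nb x, F y) (K ^ 2 * C) := by
  classical
  refine sqBound_of_sum_le fun s => ?_
  by_cases hV : s = ∅
  · subst hV
    simpa using mul_nonneg (sq_nonneg K) h.nonneg
  obtain ⟨x₀, -⟩ := Finset.nonempty_iff_ne_empty.2 hV
  have hK : 0 ≤ K := (Nat.cast_nonneg _).trans (hcard x₀)
  -- One factor `K` comes from Cauchy–Schwarz in each neighbourhood, the other from symmetry: each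
  -- `y` occurs in at most `K` of the sums.
  calc ∑ x ∈ s, (∑ y ∈ nb x, F y) ^ 2 ≤ ∑ x ∈ s, K * ∑ y ∈ nb x, F y ^ 2 := by
        refine Finset.sum_le_sum fun x _ => sq_sum_le_card_mul_sum_sq.trans ?_
        exact mul_le_mul_of_nonneg_right (hcard x) (Finset.sum_nonneg fun _ _ => sq_nonneg _)
    _ = K * ∑ y ∈ s.biUnion nb, ∑ x ∈ s with x ∈ nb y, F y ^ 2 := by
        rw [← Finset.mul_sum]
        congr 1
        refine Finset.sum_comm' fun x y => ?_
        simp only [Finset.mem_biUnion, Finset.mem_filter]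
        exact ⟨fun ⟨a, b⟩ => ⟨⟨a, hsymm x y b⟩, x, a, b⟩, fun ⟨⟨a, b⟩, _⟩ => ⟨a, hsymm y x b⟩⟩
    _ ≤ K * ∑ y ∈ s.biUnion nb, K * F y ^ 2 := by
        refine mul_le_mul_of_nonneg_left (Finset.sum_le_sum fun y _ => ?_) hK
        rw [Finset.sum_const, nsmul_eq_mul]
        refine mul_le_mul_of_nonneg_right (le_trans ?_ (hcard y)) (sq_nonneg _)
        exact_mod_cast Finset.card_le_card fun x hx => (Finset.mem_filter.1 hx).2
    _ ≤ K ^ 2 * C := by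
        rw [← Finset.mul_sum, ← mul_assoc, sq]
        exact mul_le_mul_of_nonneg_left (h.sum_le _) (mul_nonneg hK hK)

/-- Summation over the disjoint fibres `S v` of a partially defined map `anc`. -/
lemma summable_fibers {S : V → Finset V} {anc : V → V} (hS : ∀ v, ∀ y ∈ S v, anc y = v)
    {g : V → ℝ} (hg : ∀ y, 0 ≤ g y) (hsum : Summable g) :
    Summable (fun v => ∑ y ∈ S v, g y) ∧ ∑' v, ∑ y ∈ S v, g y ≤ ∑' y, g y := by
  classical
  have key : ∀ F : Finset V, ∑ v ∈ F, ∑ y ∈ S v, g y ≤ ∑' y, g y := by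
    intro F
    rw [← Finset.sum_biUnion]
    · exact hsum.sum_le_tsum _ fun _ _ => hg _
    · intro v _ v' _ hne
      refine Finset.disjoint_left.2 fun y hy hy' => hne ?_
      rw [← hS v y hy, hS v' y hy']
  have hs : Summable (fun v => ∑ y ∈ S v, g y) :=
    summable_of_sum_le (fun _ => Finset.sum_nonneg fun _ _ => hg _) key
  exact ⟨hs, hs.tsum_le_of_sum_le key⟩

/-- A weighted contraction estimate: solutions of `ω = B ω + η`, where the rows of `B` have
disjoint supports `S v` and `P` is a strictly super-harmonic weight. -/
lemma sqBound_of_contraction {S : V → Finset V} {anc : V → V}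
    (hS : ∀ v, ∀ y ∈ S v, anc y = v) {P k ω η : V → ℝ} {K C : ℝ}
    (hP1 : ∀ v, 1 ≤ P v) (hPK : ∀ v, P v ≤ K)
    (hdecay : ∀ v, 1 + ∑ y ∈ S v, k y ^ 2 * P y ≤ P v)
    (hω : Summable fun v => ω v ^ 2) (hη : SqBound η C)
    (hle : ∀ v, |ω v| ≤ ∑ y ∈ S v, k y * |ω y| + |η v|) :
    SqBound ω (4 * K ^ 2 * C) := by
  have hpos : ∀ v, 0 < P v := fun v => one_pos.trans_le (hP1 v)
  refine ⟨hω, ?_⟩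
  by_cases hV : IsEmpty V
  · simpa using mul_nonneg (by positivity) hη.nonneg
  obtain ⟨v₀⟩ := not_isEmpty_iff.1 hV
  have hK : 0 < K := (hpos v₀).trans_le (hPK v₀)
  -- With `A = ∑ k² P` and `B = ∑ ω² / P`, Cauchy–Schwarz for `(√A, 1/√2)` and `(√B, √2 |η v|)`
  -- gives `ω² ≤ (A + 1/2)(B + 2η²)`. As `A ≤ P v - 1`, half of the unit gap pays for `η`; the other
  -- half, divided by `P v ≤ K`, yields the factor `1 - 1/(2K)`.
  have hterm : ∀ v, ω v ^ 2 / P v ≤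
      (1 - 1 / (2 * K)) * (∑ y ∈ S v, ω y ^ 2 / P y + 2 * η v ^ 2) := by
    intro v
    have hA : 0 ≤ ∑ y ∈ S v, k y ^ 2 * P y :=
      Finset.sum_nonneg fun y _ => mul_nonneg (sq_nonneg _) (hpos y).le
    have hB : 0 ≤ ∑ y ∈ S v, ω y ^ 2 / P y :=
      Finset.sum_nonneg fun y _ => div_nonneg (sq_nonneg _) (hpos y).le
    have hcs : (∑ y ∈ S v, k y * |ω y|) ^ 2 ≤
        (∑ y ∈ S v, k y ^ 2 * P y) * ∑ y ∈ S v, ω y ^ 2 / P y := by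
      refine Finset.sum_sq_le_sum_mul_sum_of_sq_le_mul _ (fun y _ => mul_nonneg (sq_nonneg _) (hpos y).le)
        (fun y _ => div_nonneg (sq_nonneg _) (hpos y).le) fun y _ => ?_
      have := (hpos y).ne'
      rw [mul_pow, sq_abs]
      apply le_of_eq
      field_simp
    have hsq : ω v ^ 2 ≤ (P v - 1 / 2) * (∑ y ∈ S v, ω y ^ 2 / P y + 2 * η v ^ 2) := by
      have h1 : ω v ^ 2 ≤ (∑ y ∈ S v, k y * |ω y| + |η v|) ^ 2 := by
        rw [← sq_abs (ω v)]
        exact pow_le_pow_left₀ (abs_nonneg _) (hle v) 2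
      set A := ∑ y ∈ S v, k y ^ 2 * P y
      set B := ∑ y ∈ S v, ω y ^ 2 / P y
      set X := ∑ y ∈ S v, k y * |ω y|
      have h2 : (X + |η v|) ^ 2 ≤ (A + 1 / 2) * (B + 2 * η v ^ 2) := by
        have hx : X * |η v| * 2 ≤ B / 2 + 2 * A * η v ^ 2 := by
          rw [← sq_abs (η v)]
          have h3 : (X * |η v| * 2) ^ 2 ≤ (B / 2 + 2 * A * |η v| ^ 2) ^ 2 := by
            nlinarith [sq_nonneg (B / 2 - 2 * A * |η v| ^ 2),
              mul_le_mul_of_nonneg_right hcs (sq_nonneg |η v|)]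
          exact (abs_le.1 (abs_le_of_sq_le_sq h3 (by positivity))).2
        nlinarith [sq_abs (η v)]
      refine h1.trans (h2.trans (mul_le_mul_of_nonneg_right ?_ (by positivity)))
      linarith [hdecay v]
    rw [div_le_iff₀ (hpos v)]
    refine hsq.trans ?_
    rw [mul_right_comm]
    refine mul_le_mul_of_nonneg_right ?_ (by positivity)
    have : P v / K ≤ 1 := (div_le_one hK).2 (hPK v)
    have h4 : (1 - 1 / (2 * K)) * P v = P v - 1 / 2 * (P v / K) := by field_simp
    rw [h4]
    linarith
  have hsumP : Summable fun v => ω v ^ 2 / P v :=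
    hω.of_nonneg_of_le (fun v => div_nonneg (sq_nonneg _) (hpos v).le)
      fun v => div_le_self (sq_nonneg _) (hP1 v)
  obtain ⟨hf1, hf2⟩ := summable_fibers hS (fun v => div_nonneg (sq_nonneg (ω v)) (hpos v).le) hsumP
  have hη2 := hη.1.mul_left 2
  have hQ : ∑' v, ω v ^ 2 / P v ≤
      (1 - 1 / (2 * K)) * (∑' v, ω v ^ 2 / P v + 2 * C) := by
    have hK1 : 1 ≤ K := (hP1 v₀).trans (hPK v₀)
    have hc : 0 ≤ 1 - 1 / (2 * K) := by
      rw [sub_nonneg, div_le_one (by positivity)]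
      linarith
    calc _ ≤ ∑' v, (1 - 1 / (2 * K)) * (∑ y ∈ S v, ω y ^ 2 / P y + 2 * η v ^ 2) :=
          hsumP.tsum_le_tsum hterm ((hf1.add hη2).mul_left _)
      _ = (1 - 1 / (2 * K)) * (∑' v, ∑ y ∈ S v, ω y ^ 2 / P y + 2 * ∑' v, η v ^ 2) := by
          rw [tsum_mul_left, hf1.tsum_add hη2, tsum_mul_left]
      _ ≤ _ := mul_le_mul_of_nonneg_left (by linarith [hη.2]) hc
  have hQ2 : ∑' v, ω v ^ 2 / P v ≤ 4 * K * C := by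
    -- The weighted sum occurs on both sides of `hQ`. Since `ω` is known to be square summable, it
    -- can be absorbed on the left.
    have h5 : (∑' v, ω v ^ 2 / P v + 2 * C) / (2 * K) ≤ 2 * C := by
      have : (1 - 1 / (2 * K)) * (∑' v, ω v ^ 2 / P v + 2 * C) =
        (∑' v, ω v ^ 2 / P v + 2 * C) - (∑' v, ω v ^ 2 / P v + 2 * C) / (2 * K) := by ring
      linarith
    rw [div_le_iff₀ (by positivity)] at h5
    linarith [hη.nonneg]
  calc ∑' v, ω v ^ 2 ≤ ∑' v, K * (ω v ^ 2 / P v) := by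
        refine hω.tsum_le_tsum (fun v => ?_) (hsumP.mul_left K)
        rw [← mul_div_assoc, le_div_iff₀ (hpos v), mul_comm]
        exact mul_le_mul_of_nonneg_right (hPK v) (sq_nonneg _)
    _ = K * ∑' v, ω v ^ 2 / P v := tsum_mul_left
    _ ≤ K * (4 * K * C) := mul_le_mul_of_nonneg_left hQ2 hK.le
    _ = _ := by ring

open Classical in
/-- The dual contraction estimate: solutions of `x = Bᵀ x + η`. -/
lemma sqBound_of_dual_contraction [Nonempty V] {S : V → Finset V} {anc : V → V}
    (hS : ∀ v, ∀ y ∈ S v, anc y = v) {P k x η : V → ℝ} {K C : ℝ}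
    (hP1 : ∀ v, 1 ≤ P v) (hPK : ∀ v, P v ≤ K)
    (hdecay : ∀ v, 1 + ∑ y ∈ S v, k y ^ 2 * P y ≤ P v)
    (hx : Summable fun v => x v ^ 2) (hη : SqBound η C)
    (hle : ∀ y, |x y| ≤ (if y ∈ S (anc y) then k y * |x (anc y)| else 0) + |η y|) :
    SqBound x (K ^ 2 * (1 + K) * C) := by
  have hpos : ∀ v, 0 < P v := fun v => one_pos.trans_le (hP1 v)
  refine ⟨hx, ?_⟩
  obtain ⟨v₀⟩ := ‹Nonempty V›
  have hK1 : 1 ≤ K := (hP1 v₀).trans (hPK v₀)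
  have hK : 0 < K := by linarith
  have hxP : Summable fun v => P v * x v ^ 2 :=
    (hx.mul_left K).of_nonneg_of_le (fun v => mul_nonneg (hpos v).le (sq_nonneg _))
      fun v => mul_le_mul_of_nonneg_right (hPK v) (sq_nonneg _)
  set g : V → ℝ := fun y => if y ∈ S (anc y) then k y ^ 2 * P y * x (anc y) ^ 2 else 0 with hg
  have hfib : ∀ v, ∑ y ∈ S v, g y = (∑ y ∈ S v, k y ^ 2 * P y) * x v ^ 2 := by
    intro v
    rw [Finset.sum_mul]
    refine Finset.sum_congr rfl fun y hy => ?_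
    simp only [hg, hS v y hy, if_pos hy]
  have hg0 : ∀ y, 0 ≤ g y := fun y => by
    simp only [hg]
    split_ifs
    · exact mul_nonneg (mul_nonneg (sq_nonneg _) (hpos y).le) (sq_nonneg _)
    · exact le_rfl
  have hxP1 : Summable fun v => (P v - 1) * x v ^ 2 :=
    hxP.of_nonneg_of_le (fun v => mul_nonneg (sub_nonneg.2 (hP1 v)) (sq_nonneg _))
      fun v => mul_le_mul_of_nonneg_right (by linarith) (sq_nonneg _)
  have hgle : ∀ s : Finset V, ∑ y ∈ s, g y ≤ ∑' v, (P v - 1) * x v ^ 2 := by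
    intro s
    calc ∑ y ∈ s, g y = ∑ y ∈ s with y ∈ S (anc y), g y := by
          rw [Finset.sum_filter]
          refine Finset.sum_congr rfl fun y _ => ?_
          simp only [hg]
          split_ifs <;> rfl
      _ ≤ ∑ y ∈ (s.image anc).biUnion S, g y := by
          refine Finset.sum_le_sum_of_subset_of_nonneg (fun y hy => ?_) fun y _ _ => hg0 y
          rw [Finset.mem_filter] at hy
          exact Finset.mem_biUnion.2 ⟨anc y, Finset.mem_image_of_mem _ hy.1, hy.2⟩
      _ = ∑ v ∈ s.image anc, ∑ y ∈ S v, g y := by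
          refine Finset.sum_biUnion fun v _ v' _ hne => ?_
          refine Finset.disjoint_left.2 fun y hy hy' => hne ?_
          rw [← hS v y hy, hS v' y hy']
      _ ≤ ∑ v ∈ s.image anc, (P v - 1) * x v ^ 2 := by
          refine Finset.sum_le_sum fun v _ => ?_
          rw [hfib]
          exact mul_le_mul_of_nonneg_right (by linarith [hdecay v]) (sq_nonneg _)
      _ ≤ _ := hxP1.sum_le_tsum _ fun v _ =>
          mul_nonneg (sub_nonneg.2 (hP1 v)) (sq_nonneg _)
  have hgs : Summable g := summable_of_sum_le hg0 hgle
  have hgt : ∑' y, g y ≤ ∑' v, (P v - 1) * x v ^ 2 := hgs.tsum_le_of_sum_le hgle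
  have hηP : Summable fun v => P v * η v ^ 2 :=
    (hη.1.mul_left K).of_nonneg_of_le (fun v => mul_nonneg (hpos v).le (sq_nonneg _))
      fun v => mul_le_mul_of_nonneg_right (hPK v) (sq_nonneg _)
  have hηt : ∑' v, P v * η v ^ 2 ≤ K * C := by
    refine (hηP.tsum_le_tsum (fun v => mul_le_mul_of_nonneg_right (hPK v) (sq_nonneg _))
      (hη.1.mul_left K)).trans ?_
    rw [tsum_mul_left]
    exact mul_le_mul_of_nonneg_left hη.2 hK.le
  -- Young's inequality with parameter `1 / K`: because `P v ≤ K`, one has `(1 + 1/K)(P v - 1) ≤ P v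
  -- - 1/K`, and the surplus `1/K` controls the unweighted sum of `x²`.
  have hterm : ∀ y, P y * x y ^ 2 ≤ (1 + 1 / K) * g y + (1 + K) * (P y * η y ^ 2) := by
    intro y
    set a := if y ∈ S (anc y) then k y * |x (anc y)| else 0 with ha
    have hga : g y = P y * a ^ 2 := by
      simp only [hg, ha]
      split_ifs
      · rw [mul_pow, sq_abs]; ring
      · ring
    have h1 : x y ^ 2 ≤ (a + |η y|) ^ 2 := by
      rw [← sq_abs (x y)]
      exact pow_le_pow_left₀ (abs_nonneg _) (hle y) 2
    have h2 : (a + |η y|) ^ 2 ≤ (1 + 1 / K) * a ^ 2 + (1 + K) * η y ^ 2 := by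
      have h3 : (1 + 1 / K) * a ^ 2 + (1 + K) * η y ^ 2 - (a + |η y|) ^ 2
          = 1 / K * (a - K * |η y|) ^ 2 := by
        rw [← sq_abs (η y)]
        field_simp
        ring
      have h4 : 0 ≤ 1 / K * (a - K * |η y|) ^ 2 := by positivity
      linarith
    rw [hga]
    nlinarith [mul_le_mul_of_nonneg_left (h1.trans h2) (hpos y).le]
  have hmain : ∑' v, P v * x v ^ 2 ≤
      (1 + 1 / K) * ∑' v, (P v - 1) * x v ^ 2 + (1 + K) * (K * C) := by
    calc _ ≤ ∑' y, ((1 + 1 / K) * g y + (1 + K) * (P y * η y ^ 2)) :=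
          hxP.tsum_le_tsum hterm ((hgs.mul_left _).add (hηP.mul_left _))
      _ = (1 + 1 / K) * ∑' y, g y + (1 + K) * ∑' y, P y * η y ^ 2 := by
          rw [(hgs.mul_left _).tsum_add (hηP.mul_left _), tsum_mul_left, tsum_mul_left]
      _ ≤ _ := add_le_add (mul_le_mul_of_nonneg_left hgt (by positivity))
          (mul_le_mul_of_nonneg_left hηt (by positivity))
  have hloss : (1 + 1 / K) * ∑' v, (P v - 1) * x v ^ 2 ≤
      ∑' v, P v * x v ^ 2 - 1 / K * ∑' v, x v ^ 2 := by
    rw [← tsum_mul_left, ← tsum_mul_left, ← hxP.tsum_sub (hx.mul_left _)]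
    refine (hxP1.mul_left _).tsum_le_tsum (fun v => ?_) (hxP.sub (hx.mul_left _))
    have h1 : P v / K ≤ 1 := (div_le_one hK).2 (hPK v)
    have h2 : (1 + 1 / K) * ((P v - 1) * x v ^ 2) =
        (P v - 1 + P v / K - 1 / K) * x v ^ 2 := by ring
    rw [h2, ← sub_mul]
    exact mul_le_mul_of_nonneg_right (by linarith) (sq_nonneg _)
  have h6 : 1 / K * ∑' v, x v ^ 2 ≤ (1 + K) * (K * C) := by linarith
  have h7 := mul_le_mul_of_nonneg_left h6 hK.le
  rw [← mul_assoc, mul_one_div_cancel hK.ne', one_mul] at h7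
  linarith

end SquareSums

/-! ### Ratios along an oriented forest -/

section Forest

variable {V : Type*}

@[simp] lemma divRatio_infty (c : ℂ) : divRatio c OnePoint.infty = 0 := rfl
@[simp] lemma divRatio_coe (c z : ℂ) : divRatio c (z : OnePoint ℂ) = c / z := rfl
@[simp] lemma finVal_infty : finVal OnePoint.infty = 0 := rfl
@[simp] lemma finVal_coe (z : ℂ) : finVal (z : OnePoint ℂ) = z := rfl

lemma divRatio_eq_mul (c : ℂ) (r : OnePoint ℂ) : divRatio c r = c * divRatio 1 r := by
  induction r using OnePoint.rec with
  | infty => simp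
  | coe z => simp [div_eq_mul_inv]

lemma infty_ne_zero : (OnePoint.infty : OnePoint ℂ) ≠ ((0 : ℂ) : OnePoint ℂ) :=
  OnePoint.infty_ne_coe 0

variable [DecidableEq V]

open Classical in
/-- A ratio system on a locally finite graph with neighbourhoods `nb`, with coefficients `μ`,
ratios `R`, a strictly super-harmonic weight `P`, and a common bound `K` for all these data. -/
structure LocalRatios (nb : V → Finset V) (μ : V → V → ℂ) (R : V → V → OnePoint ℂ)
    (P : V → V → ℝ) (K : ℝ) : Prop where
  one_le : 1 ≤ K
  nb_symm : ∀ {x y}, y ∈ nb x → x ∈ nb y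
  card_le : ∀ x, ((nb x).card : ℝ) ≤ K
  coeff_symm : ∀ {x y}, y ∈ nb x → μ x y = μ y x
  coeff_ne : ∀ {x y}, y ∈ nb x → μ x y ≠ 0
  coeff_le : ∀ x y, ‖μ x y‖ ≤ K
  coeff_inv_le : ∀ x y, ‖(μ x y)⁻¹‖ ≤ K
  ratio_le : ∀ x y, ‖finVal (R x y)‖ ≤ K
  ratio_inv_le : ∀ x y, ‖divRatio 1 (R x y)‖ ≤ K
  one_le_weight : ∀ x y, 1 ≤ P x y
  weight_le : ∀ x y, P x y ≤ K
  recursion : ∀ {u v}, v ∈ nb u → R u v ≠ ((0 : ℂ) : OnePoint ℂ) →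
    0 = μ v v + divRatio (μ v u) (R u v) + ∑ y ∈ (nb v).erase u, μ v y * finVal (R v y)
  exists_top : ∀ {u v}, v ∈ nb u → R u v = ((0 : ℂ) : OnePoint ℂ) →
    ∃ y ∈ (nb v).erase u, R v y = OnePoint.infty
  eq_zero_of_top : ∀ {u v y}, v ∈ nb u → y ∈ (nb v).erase u → R v y = OnePoint.infty →
    R u v = ((0 : ℂ) : OnePoint ℂ)
  symm_ne_zero_of_top : ∀ {u v y}, v ∈ nb u → y ∈ (nb v).erase u → R v y = OnePoint.infty →
    R y v ≠ ((0 : ℂ) : OnePoint ℂ)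
  decay : ∀ {u v}, v ∈ nb u → R u v ≠ ((0 : ℂ) : OnePoint ℂ) →
    1 + ∑ y ∈ (nb v).erase u, (‖finVal (R v y)‖ ^ 2 * P v y +
      ∑ x ∈ (nb y).erase v with R y x = OnePoint.infty, ‖μ y v / μ y x‖ ^ 2 * P y x) ≤ P u v

/-- `par` orients every edge in exactly one way, each vertex of `D` having the parent `par v` and
the other vertices having none. -/
structure IsOrientation (nb : V → Finset V) (D : Set V) (par : V → V) : Prop where
  par_mem : ∀ {v}, v ∈ D → par v ∈ nb v
  cover : ∀ {x y}, y ∈ nb x → (y ∈ D ∧ par y = x) ∨ (x ∈ D ∧ par x = y)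
  par_par_ne : ∀ {v}, v ∈ D → par v ∈ D → par (par v) ≠ v

variable {nb : V → Finset V} {μ : V → V → ℂ} {R : V → V → OnePoint ℂ} {P : V → V → ℝ} {K : ℝ}
  {D : Set V} {par : V → V}

/-- If `y ≠ y'`, the infinite ratio on `(z, y')` forces ratio zero on `(y, z)`, which the infinite
ratio on `(z, y)` forbids. -/
lemma LocalRatios.top_unique (hL : LocalRatios nb μ R P K) {z y y' : V} (hy : y ∈ nb z)
    (hy' : y' ∈ nb z) (h : R z y = OnePoint.infty) (h' : R z y' = OnePoint.infty) : y = y' := by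
  by_contra hne
  exact hL.symm_ne_zero_of_top (hL.nb_symm hy') (Finset.mem_erase.2 ⟨hne, hy⟩) h
    (hL.eq_zero_of_top (hL.nb_symm hy) (Finset.mem_erase.2 ⟨Ne.symm hne, hy'⟩) h')

lemma IsOrientation.of_mem_children (hO : IsOrientation nb D par) {v y : V}
    (hy : y ∈ (nb v).erase (par v)) : y ∈ D ∧ par y = v := by
  rw [Finset.mem_erase] at hy
  rcases hO.cover hy.2 with h | h
  · exact h
  · exact absurd h.2.symm hy.1

lemma LocalRatios.mem_children (hL : LocalRatios nb μ R P K) (hO : IsOrientation nb D par) {y : V}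
    (hy : y ∈ D) (hpy : par y ∈ D) : y ∈ (nb (par y)).erase (par (par y)) :=
  Finset.mem_erase.2 ⟨(hO.par_par_ne hy hpy).symm, hL.nb_symm (hO.par_mem hy)⟩

/-- The vertices with a nonzero incoming ratio. -/
def liveSet (R : V → V → OnePoint ℂ) (D : Set V) (par : V → V) : Set V :=
  {v | v ∈ D ∧ R (par v) v ≠ ((0 : ℂ) : OnePoint ℂ)}

open Classical in
/-- Skip over a vertex with vanishing incoming ratio to its child with infinite ratio. -/
noncomputable def skip (nb : V → Finset V) (R : V → V → OnePoint ℂ) (par : V → V) (y : V) : V :=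
  if h : R (par y) y = ((0 : ℂ) : OnePoint ℂ) ∧
    ∃ x ∈ (nb y).erase (par y), R y x = OnePoint.infty then h.2.choose else y

open Classical in
/-- The last live vertex before `y`. -/
noncomputable def anc (R : V → V → OnePoint ℂ) (par : V → V) (y : V) : V :=
  if R (par y) y = OnePoint.infty then par (par y) else par y

open Classical in
/-- The modulus of the transfer coefficient from `anc y` to `y`. -/
noncomputable def transfer (μ : V → V → ℂ) (R : V → V → OnePoint ℂ) (par : V → V) (y : V) : ℝ :=
  if R (par y) y = OnePoint.infty then ‖μ (par y) (par (par y)) / μ (par y) y‖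
  else ‖finVal (R (par y) y)‖

open Classical in
/-- The live vertices following `v`. -/
noncomputable def succs (nb : V → Finset V) (R : V → V → OnePoint ℂ) (D : Set V) (par : V → V)
    (v : V) : Finset V :=
  if v ∈ liveSet R D par then ((nb v).erase (par v)).image (skip nb R par) else ∅

open Classical in
/-- The weight at live vertices. -/
noncomputable def liveWeight (R : V → V → OnePoint ℂ) (P : V → V → ℝ) (D : Set V) (par : V → V)
    (v : V) : ℝ :=
  if v ∈ liveSet R D par then P (par v) v else 1

open Classical in
/-- The deviation of `φ` from the ratio `R` on the edge `(par v, v)`. -/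
noncomputable def residual (R : V → V → OnePoint ℂ) (par : V → V) (φ : V → ℂ) (v : V) : ℂ :=
  if R (par v) v = ((0 : ℂ) : OnePoint ℂ) then φ v
  else divRatio 1 (R (par v) v) * φ v - φ (par v)

lemma skip_of_ne {y : V} (h : R (par y) y ≠ ((0 : ℂ) : OnePoint ℂ)) : skip nb R par y = y := by
  simp [skip, h]

lemma LocalRatios.skip_spec (hL : LocalRatios nb μ R P K) (hO : IsOrientation nb D par) {y : V}
    (hy : y ∈ D) (h : R (par y) y = ((0 : ℂ) : OnePoint ℂ)) :
    skip nb R par y ∈ (nb y).erase (par y) ∧ R y (skip nb R par y) = OnePoint.infty := by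
  have hex := hL.exists_top (hL.nb_symm (hO.par_mem hy)) h
  rw [skip, dif_pos ⟨h, hex⟩]
  exact hex.choose_spec

lemma LocalRatios.ne_infty_of_live (hL : LocalRatios nb μ R P K) (hO : IsOrientation nb D par)
    {v y : V} (hv : v ∈ liveSet R D par) (hy : y ∈ (nb v).erase (par v)) :
    R v y ≠ OnePoint.infty := fun h =>
  hv.2 (hL.eq_zero_of_top (hL.nb_symm (hO.par_mem hv.1)) hy h)

lemma LocalRatios.anc_skip (hL : LocalRatios nb μ R P K) (hO : IsOrientation nb D par)
    {v y : V} (hv : v ∈ liveSet R D par) (hy : y ∈ (nb v).erase (par v)) :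
    anc R par (skip nb R par y) = v := by
  obtain ⟨hyD, rfl⟩ := hO.of_mem_children hy
  by_cases h : R (par y) y = ((0 : ℂ) : OnePoint ℂ)
  · obtain ⟨h1, h2⟩ := hL.skip_spec hO hyD h
    have h3 := (hO.of_mem_children h1).2
    rw [anc, h3, if_pos h2]
  · rw [skip_of_ne h, anc, if_neg (hL.ne_infty_of_live hO hv hy)]

lemma LocalRatios.anc_of_mem_succs (hL : LocalRatios nb μ R P K) (hO : IsOrientation nb D par)
    (v y : V) (hy : y ∈ succs nb R D par v) : anc R par y = v := by
  rw [succs] at hy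
  split_ifs at hy with hv
  · obtain ⟨x, hx, rfl⟩ := Finset.mem_image.1 hy
    exact hL.anc_skip hO hv hx
  · simp at hy

/-- A skipped child is the parent of its image and so is determined by it. A skipped and an
unskipped child cannot share an image, since the image of the former is entered with ratio `∞` and
no infinite ratio leaves the live vertex `v`. -/
lemma LocalRatios.skip_injOn (hL : LocalRatios nb μ R P K) (hO : IsOrientation nb D par)
    {v : V} (hv : v ∈ liveSet R D par) :
    Set.InjOn (skip nb R par) ((nb v).erase (par v) : Finset V) := by
  have key : ∀ y ∈ (nb v).erase (par v), ∀ y' ∈ (nb v).erase (par v),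
      R (par y) y = ((0 : ℂ) : OnePoint ℂ) → skip nb R par y = skip nb R par y' → y = y' := by
    intro y hy y' hy' h heq
    obtain ⟨hyD, hpy⟩ := hO.of_mem_children hy
    obtain ⟨hyD', hpy'⟩ := hO.of_mem_children hy'
    obtain ⟨h1, h2⟩ := hL.skip_spec hO hyD h
    by_cases h' : R (par y') y' = ((0 : ℂ) : OnePoint ℂ)
    · rw [← (hO.of_mem_children h1).2, heq,
        (hO.of_mem_children (hL.skip_spec hO hyD' h').1).2]
    · rw [skip_of_ne h'] at heq
      have h3 := (hO.of_mem_children h1).2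
      rw [heq] at h2 h3
      rw [← h3, hpy'] at h2
      exact absurd h2 (hL.ne_infty_of_live hO hv hy')
  intro y hy y' hy' heq
  by_cases h : R (par y) y = ((0 : ℂ) : OnePoint ℂ)
  · exact key y hy y' hy' h heq
  by_cases h' : R (par y') y' = ((0 : ℂ) : OnePoint ℂ)
  · exact (key y' hy' y hy h' heq.symm).symm
  · rwa [skip_of_ne h, skip_of_ne h'] at heq

lemma LocalRatios.skip_mem_liveSet (hL : LocalRatios nb μ R P K) (hO : IsOrientation nb D par)
    {y : V} (hy : y ∈ D) : skip nb R par y ∈ liveSet R D par := by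
  by_cases h : R (par y) y = ((0 : ℂ) : OnePoint ℂ)
  · obtain ⟨h1, h2⟩ := hL.skip_spec hO hy h
    obtain ⟨h3, h4⟩ := hO.of_mem_children h1
    refine ⟨h3, ?_⟩
    rw [h4, h2]
    exact infty_ne_zero
  · rw [skip_of_ne h]
    exact ⟨hy, h⟩

lemma LocalRatios.one_le_liveWeight (hL : LocalRatios nb μ R P K) (v : V) :
    1 ≤ liveWeight R P D par v := by
  rw [liveWeight]
  split_ifs
  · exact hL.one_le_weight _ _
  · exact le_rfl

lemma LocalRatios.liveWeight_le (hL : LocalRatios nb μ R P K) (v : V) :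
    liveWeight R P D par v ≤ K := by
  rw [liveWeight]
  split_ifs
  · exact hL.weight_le _ _
  · exact hL.one_le

/-- By injectivity of `skip` the sum runs over the children. A child with nonzero ratio accounts for
its own term in `decay`, a child with ratio zero for the term of its grandchild behind the infinite
ratio; the terms left over are nonnegative. -/
lemma LocalRatios.liveWeight_decay (hL : LocalRatios nb μ R P K) (hO : IsOrientation nb D par)
    (v : V) : 1 + ∑ y ∈ succs nb R D par v, transfer μ R par y ^ 2 * liveWeight R P D par y ≤
      liveWeight R P D par v := by
  classical
  by_cases hv : v ∈ liveSet R D par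
  · have hw : liveWeight R P D par v = P (par v) v := by rw [liveWeight, if_pos hv]
    rw [succs, if_pos hv, Finset.sum_image (hL.skip_injOn hO hv), hw]
    refine le_trans ?_ (hL.decay (hL.nb_symm (hO.par_mem hv.1)) hv.2)
    refine add_le_add le_rfl (Finset.sum_le_sum fun y hy => ?_)
    obtain ⟨hyD, hpy⟩ := hO.of_mem_children hy
    have hP : ∀ x y, 0 ≤ P x y := fun x y => zero_le_one.trans (hL.one_le_weight x y)
    have hnn : ∀ x ∈ ((nb y).erase v).filter (fun x => R y x = OnePoint.infty),
        0 ≤ ‖μ y v / μ y x‖ ^ 2 * P y x := fun x _ => mul_nonneg (sq_nonneg _) (hP _ _)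
    rw [liveWeight, if_pos (hL.skip_mem_liveSet hO hyD)]
    by_cases h : R (par y) y = ((0 : ℂ) : OnePoint ℂ)
    · obtain ⟨h1, h2⟩ := hL.skip_spec hO hyD h
      have h3 := (hO.of_mem_children h1).2
      rw [transfer, h3, if_pos h2, hpy]
      rw [hpy] at h1
      refine le_trans ?_ (le_add_of_nonneg_left (mul_nonneg (sq_nonneg _) (hP _ _)))
      exact Finset.single_le_sum hnn (Finset.mem_filter.2 ⟨h1, h2⟩)
    · rw [skip_of_ne h, transfer, hpy, if_neg (hL.ne_infty_of_live hO hv hy)]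
      exact le_add_of_nonneg_right (Finset.sum_nonneg hnn)
  · rw [succs, liveWeight, if_neg hv, if_neg hv]
    simp

/-- If the ratio is nonzero, the residual carries a factor `1 / R` which the transfer coefficient
`|R|` undoes. If it is zero, the residual across the infinite ratio below `y` is `-φ y`, and the
transfer coefficient exchanges the coefficients of the two edges at `y`. -/
lemma LocalRatios.exists_residual_step (hL : LocalRatios nb μ R P K)
    (hO : IsOrientation nb D par) {φ : V → ℂ} {v y : V} (hv : v ∈ liveSet R D par)
    (hy : y ∈ (nb v).erase (par v)) :
    ‖μ v y * (φ y - finVal (R v y) * φ v)‖ = transfer μ R par (skip nb R par y) *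
      ‖μ (skip nb R par y) (par (skip nb R par y)) * residual R par φ (skip nb R par y)‖ := by
  obtain ⟨hyD, hpy⟩ := hO.of_mem_children hy
  have hyv : v ∈ nb y := hL.nb_symm (Finset.mem_of_mem_erase hy)
  have hsymm := hL.coeff_symm hyv
  by_cases h : R (par y) y = ((0 : ℂ) : OnePoint ℂ)
  · obtain ⟨h1, h2⟩ := hL.skip_spec hO hyD h
    have h3 := (hO.of_mem_children h1).2
    have hne := hL.coeff_ne (Finset.mem_of_mem_erase h1)
    have hs := hL.coeff_symm (Finset.mem_of_mem_erase h1)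
    rw [transfer, h3, if_pos h2, residual, h3, if_neg (by rw [h2]; exact infty_ne_zero), h2, hpy,
      ← hs, ← norm_mul, ← hsymm]
    rw [hpy] at h
    rw [h]
    simp only [norm_mul, norm_div, divRatio_infty, zero_mul, zero_sub, norm_neg, finVal_coe,
      sub_zero]
    have := norm_ne_zero_iff.2 hne
    field_simp
  · have hfin := hL.ne_infty_of_live hO hv hy
    rw [skip_of_ne h, transfer, hpy, if_neg hfin, residual, if_neg h, hpy, ← norm_mul, ← hsymm]
    rw [hpy] at h
    obtain ⟨z, hz⟩ := OnePoint.ne_infty_iff_exists.1 hfin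
    rw [← hz] at h ⊢
    have hz0 : z ≠ 0 := fun h0 => h (by rw [h0])
    simp only [finVal_coe, divRatio_coe]
    congr 1
    field_simp

/-- The recursion for the residuals of a solution of `M φ = h`. -/
lemma LocalRatios.norm_residual_le (hL : LocalRatios nb μ R P K)
    (hO : IsOrientation nb D par) {φ h : V → ℂ} {v : V} (hv : v ∈ liveSet R D par)
    (heq : h v = μ v v * φ v + ∑ y ∈ nb v, μ v y * φ y) :
    ‖μ v (par v) * residual R par φ v‖ ≤ ∑ y ∈ succs nb R D par v,
      transfer μ R par y * ‖μ y (par y) * residual R par φ y‖ + ‖h v‖ := by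
  have hpv := hO.par_mem hv.1
  rw [succs, if_pos hv, Finset.sum_image (hL.skip_injOn hO hv)]
  -- This is the equation at `v` minus `φ v` times the recursion for the ratio into `v`: the
  -- diagonal terms cancel.
  have hid : μ v (par v) * residual R par φ v =
      ∑ y ∈ (nb v).erase (par v), μ v y * (φ y - finVal (R v y) * φ v) - h v := by
    have hrec := hL.recursion (hL.nb_symm hpv) hv.2
    rw [divRatio_eq_mul] at hrec
    rw [← Finset.add_sum_erase _ _ hpv] at heq
    have hsum : ∑ y ∈ (nb v).erase (par v), μ v y * (φ y - finVal (R v y) * φ v) =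
        ∑ y ∈ (nb v).erase (par v), μ v y * φ y -
          (∑ y ∈ (nb v).erase (par v), μ v y * finVal (R v y)) * φ v := by
      rw [Finset.sum_mul, ← Finset.sum_sub_distrib]
      exact Finset.sum_congr rfl fun y _ => by ring
    rw [hsum, residual, if_neg hv.2, heq]
    linear_combination (-φ v) * hrec
  rw [hid]
  refine (norm_sub_le _ _).trans (add_le_add ((norm_sum_le _ _).trans ?_) le_rfl)
  exact Finset.sum_le_sum fun y hy => (hL.exists_residual_step hO hv hy).le

end Forest

/-! ### A priori bounds for `M φ = h` along an oriented forest -/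

section ForestBounds

variable {V : Type*} [DecidableEq V]
  {nb : V → Finset V} {μ : V → V → ℂ} {R : V → V → OnePoint ℂ} {P : V → V → ℝ} {K : ℝ}
  {D : Set V} {par : V → V}

lemma norm_le_sum_nbrs {ι : Type*} {s : Finset ι} {F : ι → ℝ} (hF : ∀ x, 0 ≤ F x) {y : ι}
    (hy : y ∈ s) : F y ≤ ∑ x ∈ s, F x :=
  Finset.single_le_sum (fun x _ => hF x) hy

open Classical in
/-- The residuals of a square-summable solution of `M φ = h` are controlled by `h`. -/
theorem LocalRatios.sqBound_residual (hL : LocalRatios nb μ R P K) (hO : IsOrientation nb D par) :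
    ∃ B : ℝ, 0 ≤ B ∧ ∀ (φ h : V → ℂ) (C : ℝ), Summable (fun v => ‖φ v‖ ^ 2) →
      SqBound (fun v => if v ∈ D then ‖h v‖ else 0) C →
      (∀ v ∈ D, h v = μ v v * φ v + ∑ y ∈ nb v, μ v y * φ y) →
      SqBound (fun v => if v ∈ D then ‖residual R par φ v‖ else 0) (B * C) := by
  have hK0 : 0 ≤ K := zero_le_one.trans hL.one_le
  refine ⟨K ^ 2 * (2 * (4 * K ^ 2) + 2 * (K ^ 2 * (4 * K ^ 2))), by positivity,
    fun φ h C hφ hh heq => ?_⟩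
  -- With the factor `μ v (par v)` the recursion for residuals has exactly the moduli whose squares
  -- are the entries of `R`.
  set ω : V → ℝ := fun v =>
    if v ∈ liveSet R D par then ‖μ v (par v) * residual R par φ v‖ else 0 with hω
  have hω0 : ∀ v, 0 ≤ ω v := fun v => by
    simp only [hω]
    split_ifs <;> positivity
  have hωs : Summable fun v => ω v ^ 2 := by
    have hφ' : SqBound (fun v => ‖φ v‖) (∑' v, ‖φ v‖ ^ 2) := ⟨hφ, le_rfl⟩
    refine (SqBound.mono (((hφ'.mul_left K).add
      (hφ'.sum_nbrs nb (fun _ _ => hL.nb_symm) hL.card_le)).mul_left K) fun v => ?_).1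
    have hS : 0 ≤ ∑ y ∈ nb v, ‖φ y‖ := Finset.sum_nonneg fun _ _ => norm_nonneg _
    have hnn : 0 ≤ K * (K * ‖φ v‖ + ∑ y ∈ nb v, ‖φ y‖) := by positivity
    rw [abs_of_nonneg hnn, abs_of_nonneg (hω0 v)]
    simp only [hω]
    split_ifs with hv
    · rw [residual, if_neg hv.2, norm_mul]
      refine mul_le_mul (hL.coeff_le _ _) ((norm_sub_le _ _).trans (add_le_add ?_ ?_))
        (norm_nonneg _) hK0
      · rw [norm_mul]
        exact mul_le_mul_of_nonneg_right (hL.ratio_inv_le _ _) (norm_nonneg _)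
      · exact norm_le_sum_nbrs (F := fun y => ‖φ y‖) (fun _ => norm_nonneg _) (hO.par_mem hv.1)
    · exact hnn
  have hωb : SqBound ω (4 * K ^ 2 * C) := by
    refine sqBound_of_contraction (hL.anc_of_mem_succs hO) hL.one_le_liveWeight hL.liveWeight_le
      (hL.liveWeight_decay hO) hωs hh fun v => ?_
    have hrhs : 0 ≤ ∑ y ∈ succs nb R D par v, transfer μ R par y * |ω y| :=
      Finset.sum_nonneg fun y _ => mul_nonneg
        (by rw [transfer]; split_ifs <;> positivity) (abs_nonneg _)
    by_cases hv : v ∈ liveSet R D par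
    · have h1 := hL.norm_residual_le hO (φ := φ) (h := h) hv (heq v hv.1)
      have h2 : ∀ y ∈ succs nb R D par v, |ω y| = ‖μ y (par y) * residual R par φ y‖ := by
        intro y hy
        rw [succs, if_pos hv] at hy
        obtain ⟨x, hx, rfl⟩ := Finset.mem_image.1 hy
        rw [abs_of_nonneg (hω0 _)]
        exact if_pos (hL.skip_mem_liveSet hO (hO.of_mem_children hx).1)
      rw [Finset.sum_congr rfl fun y hy => by rw [h2 y hy], abs_of_nonneg (hω0 _)]
      simp only [hω, if_pos hv, if_pos hv.1, abs_norm]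
      exact h1
    · have : ω v = 0 := if_neg hv
      rw [this, abs_zero]
      exact add_nonneg hrhs (abs_nonneg _)
  have hlive : ∀ v ∈ liveSet R D par, ‖residual R par φ v‖ ≤ K * ω v := by
    intro v hv
    simp only [hω, if_pos hv]
    have hne := hL.coeff_ne (hO.par_mem hv.1)
    calc ‖residual R par φ v‖ = ‖(μ v (par v))⁻¹‖ * ‖μ v (par v) * residual R par φ v‖ := by
          rw [← norm_mul, ← mul_assoc, inv_mul_cancel₀ hne, one_mul]
      _ ≤ _ := mul_le_mul_of_nonneg_right (hL.coeff_inv_le _ _) (norm_nonneg _)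
  have hfin := (hωb.add (hωb.sum_nbrs nb (fun _ _ => hL.nb_symm) hL.card_le)).mul_left K
  have hconst : K ^ 2 * (2 * (4 * K ^ 2 * C) + 2 * (K ^ 2 * (4 * K ^ 2 * C))) =
    K ^ 2 * (2 * (4 * K ^ 2) + 2 * (K ^ 2 * (4 * K ^ 2))) * C := by ring
  rw [hconst] at hfin
  refine hfin.mono fun v => ?_
  have hS : 0 ≤ ∑ y ∈ nb v, ω y := Finset.sum_nonneg fun _ _ => hω0 _
  have hnn : 0 ≤ K * (ω v + ∑ y ∈ nb v, ω y) := mul_nonneg hK0 (add_nonneg (hω0 v) hS)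
  rw [abs_of_nonneg hnn]
  split_ifs with hv
  · rw [abs_norm]
    by_cases h0 : R (par v) v = ((0 : ℂ) : OnePoint ℂ)
    · obtain ⟨h1, h2⟩ := hL.skip_spec hO hv h0
      have h3 := (hO.of_mem_children h1).2
      -- Across an infinite ratio the residual is minus the value at the tail. So the residual of a
      -- dead vertex, which is `φ v`, is controlled at a live neighbour.
      have h4 : residual R par φ (skip nb R par v) = - residual R par φ v := by
        rw [residual, residual, h3, h2, if_pos h0, if_neg infty_ne_zero]
        simp
      rw [← norm_neg, ← h4]
      refine (hlive _ (hL.skip_mem_liveSet hO hv)).trans (mul_le_mul_of_nonneg_left ?_ hK0)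
      exact (norm_le_sum_nbrs hω0 (Finset.mem_of_mem_erase h1)).trans
        (le_add_of_nonneg_left (hω0 v))
    · exact (hlive v ⟨hv, h0⟩).trans
        (mul_le_mul_of_nonneg_left (le_add_of_nonneg_right hS) hK0)
  · simpa using hnn

/-- If every vertex has a parent, then a square-summable `φ` is controlled by `h = M φ`. -/
theorem LocalRatios.sqBound_of_eq [Nonempty V] (hL : LocalRatios nb μ R P K)
    (hO : IsOrientation nb Set.univ par) :
    ∃ B : ℝ, ∀ (φ h : V → ℂ) (C : ℝ), Summable (fun v => ‖φ v‖ ^ 2) →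
      SqBound (fun v => ‖h v‖) C →
      (∀ v, h v = μ v v * φ v + ∑ y ∈ nb v, μ v y * φ y) →
      SqBound (fun v => ‖φ v‖) (B * C) := by
  classical
  obtain ⟨B₁, hB₁, hres⟩ := hL.sqBound_residual hO
  have hK1 := hL.one_le
  have hK0 : 0 ≤ K := zero_le_one.trans hK1
  -- `L₁` is the error made in solving the equation at a dead vertex for its child with infinite
  -- ratio: the outer `K` bounds the inverse coefficient, the three summands bound `h`, the diagonal
  -- term and the other children. In `L`, the term `K` serves finite ratios and `K²` a dead
  -- ancestor.
  set L₁ : ℝ := K * (1 + K + K * (1 + 2 * K) * (K + 1)) with hL₁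
  set L : ℝ := L₁ + K + K ^ 2 with hLdef
  have hL0 : 0 ≤ L := by positivity
  have hL₁0 : 0 ≤ L₁ := by positivity
  suffices ∃ B : ℝ, ∀ (φ h : V → ℂ) (C : ℝ), Summable (fun v => ‖φ v‖ ^ 2) →
      SqBound (fun v => ‖h v‖) C →
      (∀ v, h v = μ v v * φ v + ∑ y ∈ nb v, μ v y * φ y) →
      SqBound (fun v => ‖φ v‖) (B * (2 * (B₁ * C) + 2 * C)) by
    obtain ⟨B, hB⟩ := this
    refine ⟨B * (2 * B₁ + 2), fun φ h C h1 h2 h3 => ?_⟩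
    have := hB φ h C h1 h2 h3
    rwa [show B * (2 * (B₁ * C) + 2 * C) = B * (2 * B₁ + 2) * C by ring] at this
  refine ⟨2 * (K ^ 2 * (1 + K) * (L ^ 2 * (2 * (2 + 2 * K ^ 2) +
    2 * (K ^ 2 * (2 + 2 * K ^ 2))))) + 2, fun φ h C hφ hh heq => ?_⟩
  have hr := hres φ h C hφ (by simpa using hh) fun v _ => heq v
  simp only [Set.mem_univ, if_true] at hr
  set ρ := residual R par φ with hρ
  have hF := hr.add hh
  set C' := 2 * (B₁ * C) + 2 * C
  set F : V → ℝ := fun v => ‖ρ v‖ + ‖h v‖ with hFdef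
  have hnbs : ∀ x y, y ∈ nb x → x ∈ nb y := fun _ _ => hL.nb_symm
  have hG := hF.add (hF.sum_nbrs nb hnbs hL.card_le)
  -- Two enlargements by neighbours are needed, since `anc y` may be two steps away from `y`.
  set G : V → ℝ := fun v => F v + ∑ y ∈ nb v, F y with hGdef
  have hE := (hG.add (hG.sum_nbrs nb hnbs hL.card_le)).mul_left L
  set E : V → ℝ := fun v => G v + ∑ y ∈ nb v, G y with hEdef
  have hF0 : ∀ v, 0 ≤ F v := fun v => by positivity
  have hG0 : ∀ v, 0 ≤ G v := fun v => add_nonneg (hF0 v) (Finset.sum_nonneg fun _ _ => hF0 _)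
  have hE0 : ∀ v, 0 ≤ E v := fun v => add_nonneg (hG0 v) (Finset.sum_nonneg fun _ _ => hG0 _)
  have hFG : ∀ v, F v ≤ G v := fun v =>
    le_add_of_nonneg_right (Finset.sum_nonneg fun _ _ => hF0 _)
  have hFG' : ∀ v, ∀ y ∈ nb v, F y ≤ G v := fun v y hy =>
    (norm_le_sum_nbrs hF0 hy).trans (le_add_of_nonneg_left (hF0 v))
  have hGE : ∀ v, G v ≤ E v := fun v =>
    le_add_of_nonneg_right (Finset.sum_nonneg fun _ _ => hG0 _)
  have hGE' : ∀ v, ∀ y ∈ nb v, G y ≤ E v := fun v y hy =>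
    (norm_le_sum_nbrs hG0 hy).trans (le_add_of_nonneg_left (hG0 v))
  have hρF : ∀ v, ‖ρ v‖ ≤ F v := fun v => le_add_of_nonneg_right (norm_nonneg _)
  have hhF : ∀ v, ‖h v‖ ≤ F v := fun v => le_add_of_nonneg_left (norm_nonneg _)
  have hparm : ∀ v, par v ∈ nb v := fun v => hO.par_mem (Set.mem_univ v)
  have hparm' : ∀ v, v ∈ nb (par v) := fun v => hL.nb_symm (hparm v)
  have hdead : ∀ v, v ∉ liveSet R Set.univ par → R (par v) v = ((0 : ℂ) : OnePoint ℂ) := by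
    intro v hv
    by_contra h0
    exact hv ⟨Set.mem_univ v, h0⟩
  have hdeadφ : ∀ v, v ∉ liveSet R Set.univ par → ‖φ v‖ ≤ F v := by
    intro v hv
    have : ρ v = φ v := by rw [hρ, residual, if_pos (hdead v hv)]
    rw [← this]
    exact hρF v
  -- A finite ratio determines `φ` at the child up to the residual.
  have hfinite : ∀ v, R (par v) v ≠ OnePoint.infty →
      ‖φ v‖ ≤ ‖finVal (R (par v) v)‖ * ‖φ (par v)‖ + K * F v := by
    intro v hv
    by_cases h0 : R (par v) v = ((0 : ℂ) : OnePoint ℂ)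
    · rw [h0, finVal_coe, norm_zero, zero_mul, zero_add]
      refine (hdeadφ v fun h1 => h1.2 h0).trans ?_
      exact le_mul_of_one_le_left (hF0 v) hK1
    · have h1 : φ v = finVal (R (par v) v) * φ (par v) + finVal (R (par v) v) * ρ v := by
        rw [hρ, residual, if_neg h0]
        obtain ⟨z, hz⟩ := OnePoint.ne_infty_iff_exists.1 hv
        rw [← hz] at h0 ⊢
        have hz0 : z ≠ 0 := fun h2 => h0 (by rw [h2])
        simp only [finVal_coe, divRatio_coe]
        field_simp
        ring
      calc ‖φ v‖ = _ := congrArg norm h1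
        _ ≤ _ := norm_add_le _ _
        _ ≤ _ := by
          rw [norm_mul, norm_mul]
          exact add_le_add le_rfl (mul_le_mul (hL.ratio_le _ _) (hρF v) (norm_nonneg _) hK0)
  -- An infinite ratio says nothing about `φ v` directly. Its tail is dead, so `φ` is small there,
  -- and hence also at the other children, whose ratios are finite; the equation at the tail then
  -- determines `φ v` from the grandparent.
  have htop : ∀ v, R (par v) v = OnePoint.infty →
      ‖φ v‖ ≤ ‖μ (par v) (par (par v)) / μ (par v) v‖ * ‖φ (par (par v))‖ + L₁ * G (par v) := by
    intro v hv
    set z := par v with hz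
    set t := par z with ht
    have hvz : v ∈ nb z := hparm' v
    have htz : t ∈ nb z := hparm z
    have hvt : v ∈ (nb z).erase t :=
      Finset.mem_erase.2 ⟨(hO.par_par_ne (Set.mem_univ v) (Set.mem_univ _)).symm, hvz⟩
    have hR0 : R t z = ((0 : ℂ) : OnePoint ℂ) := hL.eq_zero_of_top (hparm' z) hvt hv
    have hφz : ‖φ z‖ ≤ F z := hdeadφ z fun h1 => h1.2 hR0
    have hne := hL.coeff_ne hvz
    have heqz := heq z
    rw [← Finset.add_sum_erase _ _ htz, ← Finset.add_sum_erase _ _ hvt] at heqz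
    have hsol : φ v = -(μ z t / μ z v * φ t) + (μ z v)⁻¹ *
        (h z - (μ z z * φ z + ∑ y ∈ ((nb z).erase t).erase v, μ z y * φ y)) := by
      rw [heqz]
      field_simp
      ring
    have hsib : ∀ y ∈ ((nb z).erase t).erase v, ‖μ z y * φ y‖ ≤ K * (1 + 2 * K) * (F z + F y) := by
      intro y hy
      rw [Finset.mem_erase] at hy
      have hpy := (hO.of_mem_children hy.2).2
      have hfin : R (par y) y ≠ OnePoint.infty := by
        rw [hpy]
        exact fun h1 => hy.1 (hL.top_unique (Finset.mem_of_mem_erase hy.2) hvz h1 hv)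
      have h1 := hfinite y hfin
      rw [hpy] at h1
      have h2 : ‖finVal (R z y)‖ * ‖φ z‖ ≤ K * F z :=
        mul_le_mul (hL.ratio_le _ _) hφz (norm_nonneg _) hK0
      rw [norm_mul, mul_assoc]
      refine mul_le_mul (hL.coeff_le _ _) ?_ (norm_nonneg _) hK0
      nlinarith [hF0 z, hF0 y, mul_nonneg hK0 (hF0 z), mul_nonneg hK0 (hF0 y)]
    have hsum : ‖∑ y ∈ ((nb z).erase t).erase v, μ z y * φ y‖ ≤
        K * (1 + 2 * K) * (K + 1) * G z := by
      calc _ ≤ ∑ y ∈ ((nb z).erase t).erase v, K * (1 + 2 * K) * (F z + F y) :=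
            (norm_sum_le _ _).trans (Finset.sum_le_sum hsib)
        _ ≤ ∑ y ∈ nb z, K * (1 + 2 * K) * (F z + F y) := by
            refine Finset.sum_le_sum_of_subset_of_nonneg
              (fun y hy => Finset.mem_of_mem_erase (Finset.mem_of_mem_erase hy)) fun y _ _ => ?_
            have := hF0 z
            have := hF0 y
            positivity
        _ = K * (1 + 2 * K) * ((nb z).card * F z + ∑ y ∈ nb z, F y) := by
            rw [← Finset.mul_sum, Finset.sum_add_distrib, Finset.sum_const, nsmul_eq_mul]
        _ ≤ K * (1 + 2 * K) * (K * G z + G z) := by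
            refine mul_le_mul_of_nonneg_left (add_le_add ?_ ?_) (by positivity)
            · exact mul_le_mul (hL.card_le z) (hFG z) (hF0 z) hK0
            · exact le_add_of_nonneg_left (hF0 z)
        _ = _ := by ring
    have herr : ‖(μ z v)⁻¹ *
        (h z - (μ z z * φ z + ∑ y ∈ ((nb z).erase t).erase v, μ z y * φ y))‖ ≤ L₁ * G z := by
      rw [norm_mul, hL₁, mul_assoc]
      refine mul_le_mul (hL.coeff_inv_le _ _) ?_ (norm_nonneg _) hK0
      refine (norm_sub_le _ _).trans ?_
      have h3 : ‖μ z z * φ z‖ ≤ K * G z := by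
        rw [norm_mul]
        exact mul_le_mul (hL.coeff_le _ _) (hφz.trans (hFG z)) (norm_nonneg _) hK0
      have h4 := norm_add_le (μ z z * φ z) (∑ y ∈ ((nb z).erase t).erase v, μ z y * φ y)
      have h5 := (hhF z).trans (hFG z)
      linarith
    calc ‖φ v‖ = _ := congrArg norm hsol
      _ ≤ _ := norm_add_le _ _
      _ ≤ _ := by
        rw [norm_neg, norm_mul]
        exact add_le_add le_rfl herr
  have htr : ∀ y, 0 ≤ transfer μ R par y ∧ transfer μ R par y ≤ K ^ 2 := by
    intro y
    rw [transfer]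
    split_ifs
    · refine ⟨norm_nonneg _, ?_⟩
      rw [div_eq_mul_inv, norm_mul, sq]
      exact mul_le_mul (hL.coeff_le _ _) (hL.coeff_inv_le _ _) (norm_nonneg _) hK0
    · refine ⟨norm_nonneg _, (hL.ratio_le _ _).trans ?_⟩
      nlinarith
  have hstep : ∀ y, ‖φ y‖ ≤ transfer μ R par y * ‖φ (anc R par y)‖ + (L₁ + K) * E y := by
    intro y
    rw [transfer, anc]
    split_ifs with hy
    · refine (htop y hy).trans (add_le_add le_rfl ?_)
      exact mul_le_mul (le_add_of_nonneg_right hK0) (hGE' y _ (hparm y)) (hG0 _)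
        (add_nonneg hL₁0 hK0)
    · refine (hfinite y hy).trans (add_le_add le_rfl ?_)
      exact mul_le_mul (le_add_of_nonneg_left hL₁0) ((hFG y).trans (hGE y)) (hF0 _)
        (add_nonneg hL₁0 hK0)
  have hancE : ∀ y, F (anc R par y) ≤ E y := by
    intro y
    rw [anc]
    split_ifs
    · exact (hFG' _ _ (hparm _)).trans (hGE' y _ (hparm y))
    · exact (hFG' _ _ (hparm y)).trans (hGE y)
  set x : V → ℝ := fun v => if v ∈ liveSet R Set.univ par then ‖φ v‖ else 0 with hx
  have hx0 : ∀ v, 0 ≤ x v := fun v => by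
    simp only [hx]
    split_ifs <;> positivity
  have hxs : Summable fun v => x v ^ 2 := by
    refine hφ.of_nonneg_of_le (fun _ => sq_nonneg _) fun v => ?_
    simp only [hx]
    split_ifs
    · exact le_rfl
    · simp
  -- Passing from `anc y` to `y` is the transpose of the recursion for residuals, so the same weight
  -- applies. If `anc y` is dead, then `φ` there is itself part of the error.
  have hxb := sqBound_of_dual_contraction (hL.anc_of_mem_succs hO) hL.one_le_liveWeight
    hL.liveWeight_le (hL.liveWeight_decay hO) hxs hE (fun y => by
      rw [abs_of_nonneg (hx0 y), abs_of_nonneg (hx0 _), abs_of_nonneg (mul_nonneg hL0 (hE0 y))]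
      have hEy : 0 ≤ E y := hE0 y
      by_cases hy : y ∈ liveSet R Set.univ par
      · have hxy : x y = ‖φ y‖ := if_pos hy
        have h1 := hstep y
        by_cases ha : anc R par y ∈ liveSet R Set.univ par
        · have hmem : y ∈ succs nb R Set.univ par (anc R par y) := by
            rw [succs, if_pos ha]
            by_cases hinf : R (par y) y = OnePoint.infty
            · have hanc : anc R par y = par (par y) := by rw [anc, if_pos hinf]
              rw [hanc]
              have hch := hL.mem_children hO (Set.mem_univ y) (Set.mem_univ (par y))
              have hR0 : R (par (par y)) (par y) = ((0 : ℂ) : OnePoint ℂ) :=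
                hL.eq_zero_of_top (hparm' (par y)) hch hinf
              refine Finset.mem_image.2 ⟨par y,
                hL.mem_children hO (Set.mem_univ _) (Set.mem_univ _), ?_⟩
              obtain ⟨h5, h6⟩ := hL.skip_spec hO (Set.mem_univ (par y)) hR0
              exact hL.top_unique (Finset.mem_of_mem_erase h5) (hparm' y) h6 hinf
            · have hanc : anc R par y = par y := by rw [anc, if_neg hinf]
              rw [hanc]
              exact Finset.mem_image.2 ⟨y, hL.mem_children hO (Set.mem_univ y) (Set.mem_univ _),
                skip_of_ne hy.2⟩
          have hxa : x (anc R par y) = ‖φ (anc R par y)‖ := if_pos ha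
          rw [if_pos hmem, hxy, hxa]
          refine h1.trans (add_le_add le_rfl (mul_le_mul_of_nonneg_right ?_ hEy))
          rw [hLdef]
          nlinarith [sq_nonneg K]
        · have hnm : y ∉ succs nb R Set.univ par (anc R par y) := by
            rw [succs, if_neg ha]
            simp
          rw [if_neg hnm, hxy, zero_add]
          have h2 : transfer μ R par y * ‖φ (anc R par y)‖ ≤ K ^ 2 * E y :=
            mul_le_mul (htr y).2 ((hdeadφ _ ha).trans (hancE y)) (norm_nonneg _) (sq_nonneg K)
          rw [hLdef]
          linarith
      · have hxy : x y = 0 := if_neg hy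
        rw [hxy]
        refine add_nonneg ?_ (mul_nonneg hL0 hEy)
        split_ifs
        · exact mul_nonneg (htr y).1 (hx0 _)
        · exact le_rfl)
  have hall := hxb.add hF
  have hc : 2 * (K ^ 2 * (1 + K) * (L ^ 2 * (2 * (2 * C' + 2 * (K ^ 2 * C')) +
      2 * (K ^ 2 * (2 * C' + 2 * (K ^ 2 * C')))))) + 2 * C' =
      (2 * (K ^ 2 * (1 + K) * (L ^ 2 * (2 * (2 + 2 * K ^ 2) +
        2 * (K ^ 2 * (2 + 2 * K ^ 2))))) + 2) * C' := by ring
  rw [hc] at hall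
  refine hall.mono fun v => ?_
  rw [abs_norm, abs_of_nonneg (add_nonneg (hx0 v) (hF0 v))]
  by_cases hv : v ∈ liveSet R Set.univ par
  · have : x v = ‖φ v‖ := if_pos hv
    rw [this]
    exact le_add_of_nonneg_right (hF0 v)
  · exact (hdeadφ v hv).trans (le_add_of_nonneg_left (hx0 v))

end ForestBounds

/-! ### Symmetric operators on `ℓ²(V)` -/

section Operators

variable {V : Type*} {M : L2 V →L[ℂ] L2 V}

lemma inner_delta_left (u : V) (f : L2 V) : inner ℂ (delta u) f = f u := by
  classical
  rw [delta, lp.inner_single_left]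
  simp

lemma entry_eq_apply (A : L2 V →L[ℂ] L2 V) (u v : V) : entry A u v = A (delta v) u :=
  inner_delta_left u _

lemma delta_self (v : V) : (delta v : L2 V) v = 1 := by
  classical
  rw [delta, lp.single_apply_self]

lemma delta_of_ne {v x : V} (h : x ≠ v) : (delta v : L2 V) x = 0 := by
  classical
  rw [delta, lp.single_apply_ne _ _ _ h]

lemma star_delta (v : V) : star (delta v : L2 V) = delta v := by
  ext x
  rw [lp.star_apply]
  by_cases h : x = v
  · subst h; rw [delta_self, star_one]
  · rw [delta_of_ne h, star_zero]

lemma IsSymmetric.inner_star (hM : IsSymmetric M) (f g : L2 V) :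
    inner ℂ (star f) (M g) = inner ℂ (star (M f)) g := by
  rw [← ContinuousLinearMap.adjoint_inner_left, hM, star_star]

lemma inner_star_delta_right (f : L2 V) (u : V) : inner ℂ (star f) (delta u) = f u := by
  rw [← inner_conj_symm, inner_delta_left, lp.star_apply]
  simp

lemma IsSymmetric.entry_comm (hM : IsSymmetric M) (u v : V) : entry M u v = entry M v u := by
  have h := hM.inner_star (delta u) (delta v)
  rwa [star_delta, inner_delta_left, inner_star_delta_right, ← entry_eq_apply,
    ← entry_eq_apply] at h

lemma IsSymmetric.apply_eq_tsum (hM : IsSymmetric M) (f : L2 V) (x : V) :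
    M f x = ∑' y, entry M x y * f y := by
  have h := hM.inner_star (delta x) f
  rw [star_delta, inner_delta_left, lp.inner_eq_tsum] at h
  rw [h]
  refine tsum_congr fun y => ?_
  rw [lp.star_apply, hM.entry_comm, entry_eq_apply]
  simp [mul_comm]

lemma apply_inverse (hu : IsUnit M) (f : L2 V) : M (Ring.inverse M f) = f := by
  rw [← mul_apply_eq_comp, Ring.mul_inverse_cancel M hu]
  rfl

lemma eq_zero_of_isUnit (hu : IsUnit M) {f : L2 V} (hf : M f = 0) : f = 0 := by
  have h : (Ring.inverse M * M) f = 0 := by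
    rw [mul_apply_eq_comp, hf, map_zero]
  rwa [Ring.inverse_mul_cancel M hu] at h

lemma green_comm (hM : IsSymmetric M) (hu : IsUnit M) (u v : V) : green M u v = green M v u := by
  have h := hM.inner_star (Ring.inverse M (delta u)) (Ring.inverse M (delta v))
  rw [apply_inverse hu, apply_inverse hu, star_delta, inner_delta_left,
    inner_star_delta_right] at h
  rw [green, green, entry_eq_apply, entry_eq_apply, h]

/-- The row `G(w, ·)` of the Green function. -/
noncomputable def greenRow (M : L2 V →L[ℂ] L2 V) (w : V) : L2 V := Ring.inverse M (delta w)

lemma green_eq (hM : IsSymmetric M) (hu : IsUnit M) (w v : V) : green M w v = greenRow M w v := by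
  rw [green_comm hM hu, green, entry_eq_apply, greenRow]

lemma apply_greenRow (hu : IsUnit M) (w : V) : M (greenRow M w) = delta w :=
  apply_inverse hu _

lemma greenRow_comm (hM : IsSymmetric M) (hu : IsUnit M) (v w : V) :
    greenRow M w v = greenRow M v w := by
  rw [← green_eq hM hu, green_comm hM hu, green_eq hM hu]

lemma summable_norm_sq (f : L2 V) : Summable fun v => ‖f v‖ ^ 2 := by
  have h := (lp.memℓp f).summable (by norm_num)
  simpa using h

lemma norm_sq_eq_tsum (f : L2 V) : ‖f‖ ^ 2 = ∑' v, ‖f v‖ ^ 2 := by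
  have h := lp.norm_rpow_eq_tsum (p := 2) (by norm_num) f
  simpa using h

/-- The bound makes `M` injective with closed range. The orthogonal complement of the range is the
kernel of the adjoint, and complex conjugation carries it into the kernel of `M`. -/
lemma IsSymmetric.isUnit_of_bound (hM : IsSymmetric M) {B : ℝ}
    (h : ∀ f : L2 V, ‖f‖ ^ 2 ≤ B * ‖M f‖ ^ 2) : IsUnit M := by
  have hB : ∀ f : L2 V, ‖f‖ ≤ (Real.toNNReal (Real.sqrt |B|)) * ‖M f‖ := by
    intro f
    rw [Real.coe_toNNReal _ (Real.sqrt_nonneg _)]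
    refine le_of_sq_le_sq ?_ (by positivity)
    rw [mul_pow, Real.sq_sqrt (abs_nonneg B)]
    exact (h f).trans (mul_le_mul_of_nonneg_right (le_abs_self B) (sq_nonneg _))
  have hanti := ContinuousLinearMap.antilipschitz_of_bound M hB
  rw [ContinuousLinearMap.isUnit_iff_bijective,
    ContinuousLinearMap.bijective_iff_dense_range_and_antilipschitz]
  refine ⟨?_, _, hanti⟩
  rw [Submodule.topologicalClosure_eq_top_iff, ContinuousLinearMap.orthogonal_range,
    Submodule.eq_bot_iff]
  intro f hf
  have h1 : ContinuousLinearMap.adjoint M f = 0 := hf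
  rw [hM] at h1
  have h2 : M (star f) = 0 := by simpa using h1
  have h3 : star f = 0 := hanti.injective (by rw [h2, map_zero])
  simpa using h3

end Operators

/-! ### Operators pulled back to the universal cover -/

section Cover

variable {VH VT : Type*} {H : SimpleGraph VH} {T : SimpleGraph VT} {π : VT → VH}

lemma IsUniversalCover.finite_neighborSet [Finite VH] (hπ : IsUniversalCover H T π) (x : VT) :
    (T.neighborSet x).Finite :=
  Set.Finite.of_finite_image (Set.toFinite _) (hπ.bijOn x).injOn

/-- The neighbours of `x` in `T` along edges with nonzero coefficients. -/
noncomputable def coverNbrs [Finite VH] (hπ : IsUniversalCover H T π) (X : SimpleGraph VH) (x : VT) :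
    Finset VT :=
  ((hπ.finite_neighborSet x).subset
    (fun _ hy => hy.1 : {y | T.Adj x y ∧ X.Adj (π x) (π y)} ⊆ T.neighborSet x)).toFinset

lemma mem_coverNbrs [Finite VH] {hπ : IsUniversalCover H T π} {X : SimpleGraph VH} {x y : VT} :
    y ∈ coverNbrs hπ X x ↔ T.Adj x y ∧ X.Adj (π x) (π y) := by
  simp [coverNbrs]

lemma coverNbrs_comm [Finite VH] {hπ : IsUniversalCover H T π} {X : SimpleGraph VH} {x y : VT} :
    y ∈ coverNbrs hπ X x ↔ x ∈ coverNbrs hπ X y := by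
  rw [mem_coverNbrs, mem_coverNbrs, T.adj_comm, X.adj_comm]

/-- A pullback operator on the universal cover, with the standing assumptions. -/
structure CoverOperator (H : SimpleGraph VH) (T : SimpleGraph VT) (π : VT → VH)
    (M : L2 VT →L[ℂ] L2 VT) (m : VH → VH → ℂ) : Prop where
  connected : H.Connected
  cover : IsUniversalCover H T π
  pullback : IsPullback T π M m
  symmetric : IsSymmetric M
  isLocal : IsLocal T M

variable {M : L2 VT →L[ℂ] L2 VT} {m : VH → VH → ℂ}

lemma CoverOperator.coeff_symm (hC : CoverOperator H T π M m) {x y : VT} (h : T.Adj x y) :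
    m (π x) (π y) = m (π y) (π x) := by
  rw [← hC.pullback x y (Or.inr h), ← hC.pullback y x (Or.inr h.symm), hC.symmetric.entry_comm]

lemma IsUniversalCover.adj_map (hπ : IsUniversalCover H T π) {x y : VT} (h : T.Adj x y) :
    H.Adj (π x) (π y) := (hπ.bijOn x).mapsTo h

/-- The nearest-neighbour form of the operator. -/
lemma CoverOperator.apply_eq [Finite VH] (hC : CoverOperator H T π M m) (f : L2 VT) (x : VT) :
    M f x = m (π x) (π x) * f x +
      ∑ y ∈ coverNbrs hC.cover (supportGraph H m) x, m (π x) (π y) * f y := by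
  classical
  have hx : x ∉ coverNbrs hC.cover (supportGraph H m) x := by
    rw [mem_coverNbrs]
    exact fun h => h.1.ne rfl
  rw [hC.symmetric.apply_eq_tsum,
    tsum_eq_sum (s := insert x (coverNbrs hC.cover (supportGraph H m) x)),
    Finset.sum_insert hx, hC.pullback x x (Or.inl rfl)]
  · congr 1
    refine Finset.sum_congr rfl fun y hy => ?_
    rw [hC.pullback x y (Or.inr (mem_coverNbrs.1 hy).1)]
  · intro y hy
    rw [Finset.mem_insert, not_or, mem_coverNbrs] at hy
    have h0 : entry M x y = 0 := by
      by_cases hadj : T.Adj x y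
      · rw [hC.pullback x y (Or.inr hadj)]
        by_contra hne
        exact hy.2 ⟨hadj, hC.cover.adj_map hadj, hne, hC.coeff_symm hadj ▸ hne⟩
      · exact hC.isLocal x y
          (hC.cover.isTree.connected.one_lt_dist_of_ne_of_not_adj (Ne.symm hy.1) hadj)
    rw [h0, zero_mul]

/-- The lift of the neighbour `b` of `π x` to a neighbour of `x`. -/
lemma IsUniversalCover.exists_lift (hπ : IsUniversalCover H T π) {x : VT} {b : VH}
    (h : H.Adj (π x) b) : ∃ y, T.Adj x y ∧ π y = b :=
  (hπ.bijOn x).surjOn h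

lemma IsUniversalCover.lift_unique (hπ : IsUniversalCover H T π) {x y y' : VT} (h : T.Adj x y)
    (h' : T.Adj x y') (heq : π y = π y') : y = y' :=
  (hπ.bijOn x).injOn h h' heq

lemma IsUniversalCover.surjective (hH : H.Connected) (hπ : IsUniversalCover H T π) :
    Function.Surjective π := by
  intro b
  obtain ⟨o⟩ := hπ.isTree.connected.nonempty
  obtain ⟨p⟩ := hH.preconnected (π o) b
  suffices ∀ {a b : VH} (_ : H.Walk a b) (x : VT), π x = a → ∃ y, π y = b from this p o rfl
  intro a b p
  induction p with
  | nil => exact fun x hx => ⟨x, hx⟩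
  | cons h _ ih =>
    intro x hx
    subst hx
    obtain ⟨y, -, hy⟩ := hπ.exists_lift h
    exact ih y hy

end Cover

/-! ### Super-harmonic weights and the spectral radius -/

section Matrices

variable {ι : Type*} [Fintype ι] [DecidableEq ι]

section
attribute [local instance] Matrix.linftyOpNormedRing Matrix.linftyOpNormedAlgebra

/-- Gelfand's formula, in the operator norm that dominates all row sums. -/
lemma exists_pow_rowSum_lt_one {A : Matrix ι ι ℝ}
    (h : spectralRadius ℂ (A.map (fun x : ℝ => (x : ℂ))) < 1) :
    ∃ N : ℕ, 0 < N ∧ ∃ θ < (1 : ℝ), ∀ i, ∑ j, (A ^ N) i j ≤ θ := by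
  have hG := spectrum.pow_nnnorm_pow_one_div_tendsto_nhds_spectralRadius
    (A.map (fun x : ℝ => (x : ℂ)))
  obtain ⟨N, hN, hN0⟩ := ((hG.eventually_lt_const h).and (Filter.eventually_gt_atTop 0)).exists
  refine ⟨N, hN0, ‖(A.map (fun x : ℝ => (x : ℂ))) ^ N‖, ?_, fun i => ?_⟩
  · by_contra hge
    rw [not_lt] at hge
    refine absurd hN (not_lt.2 ?_)
    refine ENNReal.one_le_rpow ?_ (by positivity)
    exact_mod_cast hge
  · have hmap : (A.map (fun x : ℝ => (x : ℂ))) ^ N = (A ^ N).map (fun x : ℝ => (x : ℂ)) :=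
      (map_pow (Complex.ofRealHom.mapMatrix (m := ι)) A N).symm
    rw [hmap, Matrix.linfty_opNorm_def]
    have h1 : ∑ j, ‖((A ^ N).map (fun x : ℝ => (x : ℂ))) i j‖₊ ≤
        Finset.univ.sup fun i => ∑ j, ‖((A ^ N).map (fun x : ℝ => (x : ℂ))) i j‖₊ :=
      Finset.le_sup (f := fun i => ∑ j, ‖((A ^ N).map (fun x : ℝ => (x : ℂ))) i j‖₊)
        (Finset.mem_univ i)
    refine le_trans ?_ (NNReal.coe_le_coe.2 h1)
    push_cast
    refine Finset.sum_le_sum fun j _ => ?_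
    simp only [Matrix.map_apply, Complex.norm_real]
    exact le_abs_self _

end

/-- A nonnegative matrix of spectral radius less than one has a strictly super-harmonic weight. -/
lemma exists_weight_of_spectralRadius_lt_one {A : Matrix ι ι ℝ} (hA : ∀ i j, 0 ≤ A i j)
    (h : spectralRadius ℂ (A.map (fun x : ℝ => (x : ℂ))) < 1) :
    ∃ p : ι → ℝ, (∀ i, 1 ≤ p i) ∧ ∀ i, 1 + ∑ j, A i j * p j ≤ p i := by
  obtain ⟨N, hN, θ, hθ, hrow⟩ := exists_pow_rowSum_lt_one h
  have hpow : ∀ n i j, 0 ≤ (A ^ n) i j := by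
    intro n
    induction n with
    | zero =>
      intro i j
      rw [pow_zero, Matrix.one_apply]
      split_ifs <;> norm_num
    | succ n ih =>
      intro i j
      rw [pow_succ, Matrix.mul_apply]
      exact Finset.sum_nonneg fun k _ => mul_nonneg (ih i k) (hA k j)
  set q : ℕ → ι → ℝ := fun n i => ∑ j, (A ^ n) i j with hq
  have hq0 : ∀ i, q 0 i = 1 := fun i => by simp [hq, Matrix.one_apply]
  have hqs : ∀ n i, ∑ j, A i j * q n j = q (n + 1) i := by
    intro n i
    simp only [hq, pow_succ', Matrix.mul_apply, Finset.mul_sum]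
    exact Finset.sum_comm
  have hqn : ∀ n i, 0 ≤ q n i := fun n i => Finset.sum_nonneg fun j _ => hpow n i j
  -- A truncated Neumann series applied to the constant `1`. Multiplication by `A` shifts it, at the
  -- cost `q N - 1 ≤ θ - 1`; division by `1 - θ` turns the gap into `1`.
  set p : ι → ℝ := fun i => ∑ n ∈ Finset.range N, q n i with hp
  have hAp : ∀ i, ∑ j, A i j * p j = p i + q N i - 1 := by
    intro i
    have h1 : ∑ j, A i j * p j = ∑ n ∈ Finset.range N, q (n + 1) i := by
      simp only [hp, Finset.mul_sum]
      rw [Finset.sum_comm]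
      exact Finset.sum_congr rfl fun n _ => hqs n i
    have h2 := Finset.sum_range_succ (fun n => q n i) N
    rw [Finset.sum_range_succ', hq0] at h2
    rw [h1]
    simp only [hp]
    linarith
  have hp1 : ∀ i, 1 ≤ p i := by
    intro i
    rw [← hq0 i]
    exact Finset.single_le_sum (f := fun n => q n i) (fun n _ => hqn n i) (Finset.mem_range.2 hN)
  have h1θ : 0 < 1 - θ := by linarith
  by_cases hι : IsEmpty ι
  · exact ⟨fun _ => 1, fun i => hι.elim i, fun i => hι.elim i⟩
  obtain ⟨i₀⟩ := not_isEmpty_iff.1 hι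
  have hθ0 : 0 ≤ θ := (hqn N i₀).trans (hrow i₀)
  have ht : 1 ≤ (1 - θ)⁻¹ := (one_le_inv₀ h1θ).2 (by linarith)
  refine ⟨fun i => (1 - θ)⁻¹ * p i, fun i => ?_, fun i => ?_⟩
  · exact one_le_mul_of_one_le_of_one_le ht (hp1 i)
  · have h3 : ∑ j, A i j * ((1 - θ)⁻¹ * p j) = (1 - θ)⁻¹ * (p i + q N i - 1) := by
      rw [← hAp, Finset.mul_sum]
      exact Finset.sum_congr rfl fun j _ => by ring
    rw [h3]
    have h4 : (1 - θ)⁻¹ * (p i + q N i - 1) ≤ (1 - θ)⁻¹ * (p i - (1 - θ)) :=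
      mul_le_mul_of_nonneg_left (by linarith [hrow i]) (by positivity)
    have h5 : (1 - θ)⁻¹ * (p i - (1 - θ)) = (1 - θ)⁻¹ * p i - 1 := by
      rw [mul_sub, inv_mul_cancel₀ h1θ.ne']
    rw [h5] at h4
    linarith

/-- A nonnegative matrix with a strictly super-harmonic weight has spectral radius less than
one. -/
lemma spectralRadius_lt_one_of_weight {A : Matrix ι ι ℝ} (hA : ∀ i j, 0 ≤ A i j)
    {p : ι → ℝ} (hp : ∀ i, 1 ≤ p i) (hdecay : ∀ i, 1 + ∑ j, A i j * p j ≤ p i) :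
    spectralRadius ℂ (A.map (fun x : ℝ => (x : ℂ))) < 1 := by
  have hpos : ∀ i, 0 < p i := fun i => one_pos.trans_le (hp i)
  obtain ⟨B, hB⟩ : ∃ B : ℝ, ∀ i, p i ≤ B := by
    obtain ⟨B, hB⟩ := (Set.finite_range p).bddAbove
    exact ⟨B, fun i => hB ⟨i, rfl⟩⟩
  -- For an eigenvector `v`, the equation at an index maximizing `‖v i‖ / p i` gives `‖k‖ p i ≤ p i
  -- - 1`; the upper bound on `p` makes the gap uniform.
  have key : ∀ k ∈ spectrum ℂ (A.map (fun x : ℝ => (x : ℂ))), ‖k‖ ≤ 1 - (max B 1)⁻¹ := by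
    intro k hk
    rw [← Matrix.spectrum_toLin', ← Module.End.hasEigenvalue_iff_mem_spectrum] at hk
    obtain ⟨v, hv, hv0⟩ := hk.exists_hasEigenvector
    rw [Module.End.mem_eigenspace_iff, Matrix.toLin'_apply] at hv
    obtain ⟨i₁, hi₁⟩ : ∃ i, v i ≠ 0 := Function.ne_iff.1 hv0
    obtain ⟨i, -, hi⟩ := Finset.exists_max_image Finset.univ (fun i => ‖v i‖ / p i)
      ⟨i₁, Finset.mem_univ _⟩
    set t := ‖v i‖ / p i with ht
    have ht0 : 0 < t := lt_of_lt_of_le (div_pos (norm_pos_iff.2 hi₁) (hpos i₁))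
      (hi i₁ (Finset.mem_univ _))
    have hvt : ∀ j, ‖v j‖ ≤ t * p j := fun j => (div_le_iff₀ (hpos j)).1 (hi j (Finset.mem_univ _))
    have hvi : ‖v i‖ = t * p i := by rw [ht, div_mul_cancel₀ _ (hpos i).ne']
    have h1 : ‖k‖ * ‖v i‖ ≤ t * ∑ j, A i j * p j := by
      have h2 : k * v i = ∑ j, (A i j : ℂ) * v j := by
        have := congrFun hv i
        rw [Pi.smul_apply, smul_eq_mul] at this
        rw [← this]
        rfl
      rw [← norm_mul, h2, Finset.mul_sum]
      refine (norm_sum_le _ _).trans (Finset.sum_le_sum fun j _ => ?_)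
      rw [norm_mul, Complex.norm_real, Real.norm_of_nonneg (hA i j)]
      nlinarith [mul_le_mul_of_nonneg_left (hvt j) (hA i j)]
    rw [hvi] at h1
    have h3 : ‖k‖ * p i ≤ p i - 1 := by
      have h4 : t * (‖k‖ * p i) ≤ t * (p i - 1) := by
        nlinarith [mul_le_mul_of_nonneg_left (hdecay i) ht0.le]
      exact le_of_mul_le_mul_left h4 ht0
    have h5 : (max B 1)⁻¹ * p i ≤ 1 := by
      rw [inv_mul_le_one₀ (by positivity)]
      exact (hB i).trans (le_max_left _ _)
    have h6 : ‖k‖ * p i ≤ (1 - (max B 1)⁻¹) * p i := by linarith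
    exact le_of_mul_le_mul_right h6 (hpos i)
  have hc : 1 - (max B 1)⁻¹ < 1 := by
    have : 0 < (max B 1)⁻¹ := by positivity
    linarith
  refine lt_of_le_of_lt (iSup₂_le fun k hk => ?_) (ENNReal.ofReal_lt_one.2 hc)
  rw [← enorm_eq_nnnorm, ← ofReal_norm]
  exact ENNReal.ofReal_le_ofReal (key k hk)

end Matrices

/-! ### Ratio systems on the universal cover -/

section Extend

variable {VH : Type*} {H X : SimpleGraph VH} {m : VH → VH → ℂ}

lemma supportGraph_le : supportGraph H m ≤ H := fun _ _ h => h.1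

open Classical in
/-- Extension by `d` of a function on the directed edges to all pairs of vertices. -/
noncomputable def extendDart {β : Type*} (X : SimpleGraph VH) (r : X.Dart → β) (d : β)
    (a b : VH) : β :=
  if h : X.Adj a b then r ⟨(a, b), h⟩ else d

lemma extendDart_of_adj {β : Type*} {r : X.Dart → β} {d : β} {a b : VH} (h : X.Adj a b) :
    extendDart X r d a b = r ⟨(a, b), h⟩ := dif_pos h

end Extend

section Lift

variable {VH VT : Type*} [Fintype VH] {H : SimpleGraph VH} {T : SimpleGraph VT} {π : VT → VH}
  {m : VH → VH → ℂ} {X : SimpleGraph VH}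

lemma decayMatrix_nonneg (r : X.Dart → OnePoint ℂ) (e f) : 0 ≤ decayMatrix X m r e f := by
  rw [decayMatrix]
  split_ifs
  · exact Finset.sum_nonneg fun _ _ => sq_nonneg _
  · exact sq_nonneg _
  · exact le_rfl

open Classical in
lemma exists_weight_of_decayRate_lt_one {r : X.Dart → OnePoint ℂ} (hd : decayRate X m r < 1) :
    ∃ p : {e : X.Dart // r e ≠ ((0 : ℂ) : OnePoint ℂ)} → ℝ, (∀ e, 1 ≤ p e) ∧
      ∀ e, 1 + ∑ f, decayMatrix X m r e f * p f ≤ p e := by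
  rw [decayRate] at hd
  exact exists_weight_of_spectralRadius_lt_one (decayMatrix_nonneg r) hd

open Classical in
lemma decayRate_lt_one_of_weight {r : X.Dart → OnePoint ℂ}
    {p : {e : X.Dart // r e ≠ ((0 : ℂ) : OnePoint ℂ)} → ℝ} (hp : ∀ e, 1 ≤ p e)
    (h : ∀ e, 1 + ∑ f, decayMatrix X m r e f * p f ≤ p e) : decayRate X m r < 1 := by
  rw [decayRate]
  exact spectralRadius_lt_one_of_weight (decayMatrix_nonneg r) hp h

open Classical in
/-- The action of the decay matrix as a nested sum over successors. -/
lemma sum_decayMatrix_mul (r : X.Dart → OnePoint ℂ) (p : X.Dart → ℝ)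
    (e : {e : X.Dart // r e ≠ ((0 : ℂ) : OnePoint ℂ)}) :
    ∑ f, decayMatrix X m r e f * p f.1 =
      ∑ g : X.Dart with Follows e.1 g, (‖finVal (r g)‖ ^ 2 * p g +
        ∑ f : X.Dart with Follows g f ∧ r f = OnePoint.infty,
          ‖m g.snd g.fst / m f.fst f.snd‖ ^ 2 * p f) := by
  have h1 : ∑ f, decayMatrix X m r e f * p f.1 =
      ∑ f : X.Dart with r f ≠ ((0 : ℂ) : OnePoint ℂ), (if r f = OnePoint.infty then
        ∑ g : X.Dart with Follows e.1 g ∧ Follows g f, ‖m g.snd g.fst / m f.fst f.snd‖ ^ 2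
        else if Follows e.1 f then ‖finVal (r f)‖ ^ 2 else 0) * p f :=
    (Finset.sum_subtype (Finset.univ.filter fun f : X.Dart => r f ≠ ((0 : ℂ) : OnePoint ℂ))
      (by simp) (fun f : X.Dart => (if r f = OnePoint.infty then
        ∑ g : X.Dart with Follows e.1 g ∧ Follows g f, ‖m g.snd g.fst / m f.fst f.snd‖ ^ 2
        else if Follows e.1 f then ‖finVal (r f)‖ ^ 2 else 0) * p f)).symm
  have h2 : ∀ f : X.Dart, (if r f ≠ ((0 : ℂ) : OnePoint ℂ) then (if r f = OnePoint.infty then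
        ∑ g : X.Dart with Follows e.1 g ∧ Follows g f, ‖m g.snd g.fst / m f.fst f.snd‖ ^ 2
        else if Follows e.1 f then ‖finVal (r f)‖ ^ 2 else 0) * p f else 0) =
      (if Follows e.1 f then ‖finVal (r f)‖ ^ 2 * p f else 0) +
      ∑ g : X.Dart with Follows e.1 g, (if Follows g f ∧ r f = OnePoint.infty then
        ‖m g.snd g.fst / m f.fst f.snd‖ ^ 2 * p f else 0) := by
    intro f
    by_cases hinf : r f = OnePoint.infty
    · simp only [hinf, ne_eq, infty_ne_zero, not_false_eq_true, if_true, finVal_infty, norm_zero,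
        and_true]
      rw [← Finset.sum_filter, Finset.filter_filter, Finset.sum_mul]
      simp
    · simp only [hinf, if_false, and_false, Finset.sum_const_zero, add_zero]
      by_cases h0 : r f = ((0 : ℂ) : OnePoint ℂ)
      · simp [h0]
      · simp only [ne_eq, h0, not_false_eq_true, if_true]
        split_ifs <;> simp
  rw [h1, Finset.sum_filter, Finset.sum_congr rfl fun f _ => h2 f, Finset.sum_add_distrib,
    ← Finset.sum_filter, Finset.sum_comm, ← Finset.sum_add_distrib]
  refine Finset.sum_congr rfl fun g _ => ?_
  rw [Finset.sum_filter]

/-- Since `π` is bijective on the neighbours of `v`, excluding the reverse edge in `X` is the same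
as excluding `u` in the cover. -/
lemma follows_iff (hπ : IsUniversalCover H T π) (hX : X ≤ H) {u v : VT} (huv : T.Adj u v)
    (h : X.Adj (π u) (π v)) (f : X.Dart) :
    Follows (⟨(π u, π v), h⟩ : X.Dart) f ↔
      ∃ y, y ∈ coverNbrs hπ X v ∧ y ≠ u ∧ f.fst = π v ∧ f.snd = π y := by
  constructor
  · rintro ⟨h1, h2⟩
    have h1' : f.fst = π v := h1.symm
    have hf : X.Adj (π v) f.snd := h1' ▸ f.adj
    obtain ⟨y, hy, hy'⟩ := hπ.exists_lift (hX hf)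
    refine ⟨y, mem_coverNbrs.2 ⟨hy, hy'.symm ▸ hf⟩, ?_, h1', hy'.symm⟩
    rintro rfl
    exact h2 (SimpleGraph.Dart.ext _ _ (Prod.ext h1' hy'.symm))
  · rintro ⟨y, hy, hyu, h1, h2⟩
    refine ⟨h1.symm, fun heq => hyu ?_⟩
    have h3 : f.snd = π u := by rw [heq]; rfl
    exact hπ.lift_unique (mem_coverNbrs.1 hy).1 huv.symm (h2.symm.trans h3)

open Classical in
/-- Sums over the successors of a directed edge are sums over neighbours in the cover. -/
lemma sum_follows [DecidableEq VT] {β : Type*} [AddCommMonoid β] (hπ : IsUniversalCover H T π) (hX : X ≤ H)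
    {u v : VT} (huv : T.Adj u v) (h : X.Adj (π u) (π v)) (G : X.Dart → β) (G' : VT → β)
    (hG : ∀ y, ∀ hy : X.Adj (π v) (π y), y ∈ coverNbrs hπ X v → y ≠ u →
      G ⟨(π v, π y), hy⟩ = G' y) :
    ∑ f : X.Dart with Follows (⟨(π u, π v), h⟩ : X.Dart) f, G f =
      ∑ y ∈ (coverNbrs hπ X v).erase u, G' y := by
  symm
  have hadj : ∀ y ∈ (coverNbrs hπ X v).erase u, X.Adj (π v) (π y) := fun y hy =>
    (mem_coverNbrs.1 (Finset.mem_of_mem_erase hy)).2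
  refine Finset.sum_bij (fun y hy => (⟨(π v, π y), hadj y hy⟩ : X.Dart)) ?_ ?_ ?_ ?_
  · intro y hy
    rw [Finset.mem_filter]
    refine ⟨Finset.mem_univ _, (follows_iff hπ hX huv h _).2 ⟨y, Finset.mem_of_mem_erase hy,
      (Finset.mem_erase.1 hy).1, rfl, rfl⟩⟩
  · intro y hy y' hy' heq
    have h1 : π y = π y' := congrArg (fun d : X.Dart => d.snd) heq
    exact hπ.lift_unique (mem_coverNbrs.1 (Finset.mem_of_mem_erase hy)).1
      (mem_coverNbrs.1 (Finset.mem_of_mem_erase hy')).1 h1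
  · intro f hf
    obtain ⟨y, hy, hyu, h1, h2⟩ := (follows_iff hπ hX huv h f).1 (Finset.mem_filter.1 hf).2
    exact ⟨y, Finset.mem_erase.2 ⟨hyu, hy⟩, SimpleGraph.Dart.ext _ _ (Prod.ext h1.symm h2.symm)⟩
  · intro y hy
    exact (hG y _ (Finset.mem_of_mem_erase hy) (Finset.mem_erase.1 hy).1).symm

end Lift

/-! ### Lifting ratios and weights to the cover -/

section LiftRatios

variable {VH VT : Type*} [Fintype VH] {H : SimpleGraph VH} {T : SimpleGraph VT} {π : VT → VH}
  {M : L2 VT →L[ℂ] L2 VT} {m : VH → VH → ℂ}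

lemma exists_bound_pair (f : VH → VH → ℝ) : ∃ B, ∀ a b, f a b ≤ B := by
  obtain ⟨B, hB⟩ := (Set.finite_range (fun q : VH × VH => f q.1 q.2)).bddAbove
  exact ⟨B, fun a b => hB ⟨(a, b), rfl⟩⟩

lemma card_coverNbrs_le (hπ : IsUniversalCover H T π) (X : SimpleGraph VH) (x : VT) :
    (coverNbrs hπ X x).card ≤ Fintype.card VH := by
  classical
  rw [← Finset.card_image_of_injOn (f := π) (s := coverNbrs hπ X x)]
  · exact Finset.card_le_univ _
  · intro y hy y' hy' heq
    exact hπ.lift_unique (mem_coverNbrs.1 hy).1 (mem_coverNbrs.1 hy').1 heq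

/-- The ratio on pairs of vertices of the cover. -/
noncomputable def coverRatio (π : VT → VH) {X : SimpleGraph VH} (r : X.Dart → OnePoint ℂ)
    (x y : VT) : OnePoint ℂ :=
  extendDart X r ((0 : ℂ) : OnePoint ℂ) (π x) (π y)

open Classical in
/-- A weight on the directed edges with nonzero ratio, extended by `1` to all pairs of
vertices. -/
noncomputable def extendWeight {X : SimpleGraph VH} {r : X.Dart → OnePoint ℂ}
    (p : {e : X.Dart // r e ≠ ((0 : ℂ) : OnePoint ℂ)} → ℝ) (a b : VH) : ℝ :=
  extendDart X (fun e => if h : r e ≠ ((0 : ℂ) : OnePoint ℂ) then p ⟨e, h⟩ else 1) 1 a b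

open Classical in
/-- The action of the decay matrix, computed in the cover. -/
lemma sum_decayMatrix_cover [DecidableEq VT] (hπ : IsUniversalCover H T π)
    (r : (supportGraph H m).Dart → OnePoint ℂ)
    (p : {e : (supportGraph H m).Dart // r e ≠ ((0 : ℂ) : OnePoint ℂ)} → ℝ) {u v : VT}
    (huv : T.Adj u v) (h : (supportGraph H m).Adj (π u) (π v))
    (h0 : r ⟨(π u, π v), h⟩ ≠ ((0 : ℂ) : OnePoint ℂ)) :
    ∑ f, decayMatrix (supportGraph H m) m r ⟨⟨(π u, π v), h⟩, h0⟩ f * p f =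
      ∑ y ∈ (coverNbrs hπ (supportGraph H m) v).erase u,
        (‖finVal (coverRatio π r v y)‖ ^ 2 * extendWeight p (π v) (π y) +
        ∑ x ∈ (coverNbrs hπ (supportGraph H m) y).erase v with coverRatio π r y x = OnePoint.infty,
          ‖m (π y) (π v) / m (π y) (π x)‖ ^ 2 * extendWeight p (π y) (π x)) := by
  set q : (supportGraph H m).Dart → ℝ :=
    fun e => if h : r e ≠ ((0 : ℂ) : OnePoint ℂ) then p ⟨e, h⟩ else 1 with hq
  have hp : ∀ f : {e : (supportGraph H m).Dart // r e ≠ ((0 : ℂ) : OnePoint ℂ)}, p f = q f.1 :=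
    fun f => by simp [hq, f.2]
  simp only [hp]
  rw [sum_decayMatrix_mul]
  refine sum_follows hπ supportGraph_le huv h _ _ fun y hy hyn hyu => ?_
  rw [coverRatio, extendWeight, extendDart_of_adj hy, extendDart_of_adj hy]
  congr 1
  rw [← Finset.filter_filter, Finset.sum_filter,
    Finset.sum_filter (s := (coverNbrs hπ (supportGraph H m) y).erase v)]
  refine sum_follows hπ supportGraph_le (mem_coverNbrs.1 hyn).1 hy _ _ fun x hx _ _ => ?_
  rw [coverRatio, extendWeight, extendDart_of_adj hx, extendDart_of_adj hx]

/-- A ratio system of decay rate less than one lifts to the universal cover. -/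
theorem CoverOperator.exists_localRatios [DecidableEq VT] (hC : CoverOperator H T π M m)
    {r : (supportGraph H m).Dart → OnePoint ℂ} (hr : IsRatioSystem (supportGraph H m) m r)
    (hd : decayRate (supportGraph H m) m r < 1) :
    ∃ P K, LocalRatios (coverNbrs hC.cover (supportGraph H m)) (fun x y => m (π x) (π y))
      (coverRatio π r) P K := by
  classical
  obtain ⟨p, hp1, hpd⟩ := exists_weight_of_decayRate_lt_one hd
  set Q : VH → VH → ℝ := extendWeight p with hQ
  set ρ : VH → VH → OnePoint ℂ := extendDart (supportGraph H m) r ((0 : ℂ) : OnePoint ℂ) with hρ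
  obtain ⟨B, hB⟩ := exists_bound_pair fun a b => max ‖m a b‖ (max ‖(m a b)⁻¹‖
    (max ‖finVal (ρ a b)‖ (max ‖divRatio 1 (ρ a b)‖ (Q a b))))
  simp only [max_le_iff] at hB
  have hBK : B ≤ max (max 1 B) (Fintype.card VH) := (le_max_right _ _).trans (le_max_left _ _)
  refine ⟨fun x y => Q (π x) (π y), max (max 1 B) (Fintype.card VH), ?_⟩
  have hr_eq : ∀ {u v : VT} (h : (supportGraph H m).Adj (π u) (π v)), coverRatio π r u v = r ⟨(π u, π v), h⟩ :=
    fun h => extendDart_of_adj h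
  have hfol : ∀ {u v y : VT} (hu : v ∈ coverNbrs hC.cover (supportGraph H m) u)
      (hy : y ∈ (coverNbrs hC.cover (supportGraph H m) v).erase u),
      Follows (⟨(π u, π v), (mem_coverNbrs.1 hu).2⟩ : (supportGraph H m).Dart)
        ⟨(π v, π y), (mem_coverNbrs.1 (Finset.mem_of_mem_erase hy)).2⟩ := fun hu hy =>
    (follows_iff hC.cover supportGraph_le (mem_coverNbrs.1 hu).1 (mem_coverNbrs.1 hu).2 _).2
      ⟨_, Finset.mem_of_mem_erase hy, (Finset.mem_erase.1 hy).1, rfl, rfl⟩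
  constructor
  · exact (le_max_left _ _).trans (le_max_left _ _)
  · exact fun h => coverNbrs_comm.1 h
  · exact fun x => le_trans (by exact_mod_cast card_coverNbrs_le hC.cover (supportGraph H m) x) (le_max_right _ _)
  · exact fun h => hC.coeff_symm (mem_coverNbrs.1 h).1
  · exact fun h => (mem_coverNbrs.1 h).2.2.1
  · exact fun x y => (hB _ _).1.trans hBK
  · exact fun x y => (hB _ _).2.1.trans hBK
  · exact fun x y => (hB _ _).2.2.1.trans hBK
  · exact fun x y => (hB _ _).2.2.2.1.trans hBK
  · intro x y
    simp only [hQ, extendWeight, extendDart]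
    split_ifs
    · exact hp1 _
    · exact le_rfl
    · exact le_rfl
  · exact fun x y => (hB _ _).2.2.2.2.trans hBK
  · intro u v hv h0
    have hadj := (mem_coverNbrs.1 hv).2
    rw [hr_eq hadj] at h0 ⊢
    have h1 := hr.recursion _ h0
    rw [sum_follows (G' := fun y => m (π v) (π y) * finVal (coverRatio π r v y)) hC.cover
      supportGraph_le (mem_coverNbrs.1 hv).1 hadj _ fun y hy _ _ => by rw [hr_eq hy]] at h1
    exact h1
  · intro u v hv h0
    have hadj := (mem_coverNbrs.1 hv).2
    rw [hr_eq hadj] at h0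
    obtain ⟨f, hf, hf'⟩ := hr.exists_top _ h0
    obtain ⟨y, hy, hyu, h1, h2⟩ :=
      (follows_iff hC.cover supportGraph_le (mem_coverNbrs.1 hv).1 hadj f).1 hf
    refine ⟨y, Finset.mem_erase.2 ⟨hyu, hy⟩, ?_⟩
    rw [hr_eq (mem_coverNbrs.1 hy).2, ← hf']
    congr 1
    exact SimpleGraph.Dart.ext _ _ (Prod.ext h1.symm h2.symm)
  · intro u v y hv hy h
    rw [hr_eq (mem_coverNbrs.1 (Finset.mem_of_mem_erase hy)).2] at h
    rw [hr_eq (mem_coverNbrs.1 hv).2]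
    exact hr.eq_zero_of_top _ _ h (hfol hv hy)
  · intro u v y hv hy h
    rw [hr_eq (mem_coverNbrs.1 (Finset.mem_of_mem_erase hy)).2] at h
    rw [hr_eq (mem_coverNbrs.1 (Finset.mem_of_mem_erase hy)).2.symm]
    exact hr.symm_ne_zero_of_top _ _ h (hfol hv hy)
  · intro u v hv h0
    have hadj := (mem_coverNbrs.1 hv).2
    rw [hr_eq hadj] at h0
    have h1 := hpd ⟨⟨(π u, π v), hadj⟩, h0⟩
    rw [sum_decayMatrix_cover hC.cover r p (mem_coverNbrs.1 hv).1 hadj h0] at h1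
    have h2 : Q (π u) (π v) = p ⟨⟨(π u, π v), hadj⟩, h0⟩ := by
      rw [hQ, extendWeight, extendDart_of_adj hadj, dif_pos h0]
    simp only [h2]
    convert! h1 using 5

end LiftRatios

/-! ### Rooted trees -/

section Trees

variable {V : Type*} {T : SimpleGraph V}

open Classical in
/-- The neighbour of `v` in the direction of the root `o`. -/
noncomputable def treeParent (T : SimpleGraph V) (o v : V) : V :=
  if h : ∃ y, T.Adj v y ∧ T.dist o y < T.dist o v then h.choose else v

/-- A geodesic from `o` to a closer neighbour is too short to pass through `v`, so that neighbour is
the penultimate vertex of the path from `o` to `v`. -/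
lemma eq_of_dist_lt (hT : T.IsTree) {o v y y' : V} (hy : T.Adj v y)
    (hlt : T.dist o y < T.dist o v) (hy' : T.Adj v y') (hlt' : T.dist o y' < T.dist o v) :
    y = y' := by
  classical
  obtain ⟨p, hp, hpl⟩ := hT.connected.exists_path_of_dist o v
  suffices ∀ z, T.Adj v z → T.dist o z < T.dist o v → z = p.penultimate by
    rw [this y hy hlt, this y' hy' hlt']
  intro z hz hzlt
  obtain ⟨q, hq, hql⟩ := hT.connected.exists_path_of_dist o z
  refine hT.isAcyclic.eq_penultimate_of_adj_end hp hz
    (hT.isAcyclic.mem_support_of_ne_mem_support_of_adj_of_isPath hp hq hz fun hv => ?_)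
  have h1 := SimpleGraph.dist_le (q.takeUntil v hv)
  have h2 := q.length_takeUntil_le_length hv
  omega

lemma treeParent_eq (hT : T.IsTree) {o v y : V} (hy : T.Adj v y)
    (hlt : T.dist o y < T.dist o v) : treeParent T o v = y := by
  have h : ∃ y, T.Adj v y ∧ T.dist o y < T.dist o v := ⟨y, hy, hlt⟩
  rw [treeParent, dif_pos h]
  exact eq_of_dist_lt hT h.choose_spec.1 h.choose_spec.2 hy hlt

lemma dist_lt_or_lt (hT : T.IsTree) (o : V) {x y : V} (h : T.Adj x y) :
    T.dist o x < T.dist o y ∨ T.dist o y < T.dist o x :=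
  lt_or_gt_of_ne (hT.dist_ne_of_adj o h)

lemma OnPath.dist_lt (hT : T.IsTree) {w u v : V} (huv : T.Adj u v) (h : OnPath T w u v) :
    T.dist w u < T.dist w v := by
  classical
  obtain ⟨p, hp, hu⟩ := h
  obtain ⟨q, hq, hql⟩ := hT.connected.exists_path_of_dist w v
  have hpq : p = q := (hT.existsUnique_path w v).unique hp hq
  have h1 := SimpleGraph.dist_le (p.takeUntil u hu)
  have h2 := p.length_takeUntil_lt_length hu huv.ne
  have h3 : p.length = q.length := by rw [hpq]
  omega

end Trees

/-! ### Ratios of the Green function, from the tree rooted at its source -/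

section GreenRatios

variable {VH VT : Type*} [Fintype VH] {H : SimpleGraph VH} {T : SimpleGraph VT} {π : VT → VH}
  {M : L2 VT →L[ℂ] L2 VT} {m : VH → VH → ℂ}

/-- The orientation of the edges away from the root `o`. -/
lemma isOrientation_treeParent (hπ : IsUniversalCover H T π) (X : SimpleGraph VH) (o : VT) :
    IsOrientation (coverNbrs hπ X)
      {v | ∃ y ∈ coverNbrs hπ X v, T.dist o y < T.dist o v} (treeParent T o) where
  par_mem := by
    rintro v ⟨y, hy, hlt⟩
    rwa [treeParent_eq hπ.isTree (mem_coverNbrs.1 hy).1 hlt]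
  cover := by
    intro x y hy
    have hadj := (mem_coverNbrs.1 hy).1
    rcases dist_lt_or_lt hπ.isTree o hadj with h | h
    · exact Or.inl ⟨⟨x, coverNbrs_comm.1 hy, h⟩, treeParent_eq hπ.isTree hadj.symm h⟩
    · exact Or.inr ⟨⟨y, hy, h⟩, treeParent_eq hπ.isTree hadj h⟩
  par_par_ne := by
    rintro v ⟨y, hy, hlt⟩ hpar
    rw [treeParent_eq hπ.isTree (mem_coverNbrs.1 hy).1 hlt] at hpar ⊢
    obtain ⟨z, hz, hlt'⟩ := hpar
    rw [treeParent_eq hπ.isTree (mem_coverNbrs.1 hz).1 hlt']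
    rintro rfl
    omega

lemma genRatio_eq_of_residual {V : Type*} {R : V → V → OnePoint ℂ} {par : V → V} {φ : V → ℂ}
    {v : V} (h : residual R par φ v = 0) (hne : ¬ (φ (par v) = 0 ∧ φ v = 0)) :
    genRatio (φ v) (φ (par v)) = R (par v) v := by
  rw [residual] at h
  split_ifs at h with h0
  · have hu : φ (par v) ≠ 0 := fun hu => hne ⟨hu, h⟩
    rw [genRatio, if_neg hu, h, zero_div, h0]
  · generalize R (par v) v = ρ at *
    induction ρ using OnePoint.rec with
    | infty =>
      rw [divRatio_infty, zero_mul, zero_sub, neg_eq_zero] at h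
      rw [genRatio, if_pos h]
    | coe z =>
      have hz0 : z ≠ 0 := fun h1 => h0 (by rw [h1])
      rw [divRatio_coe, sub_eq_zero] at h
      have hu : φ (par v) ≠ 0 := by
        intro hu
        rw [hu] at h
        have hv : φ v = 0 := by
          rcases mul_eq_zero.1 h with h1 | h1
          · exact absurd h1 (one_div_ne_zero hz0)
          · exact h1
        exact hne ⟨hu, hv⟩
      have hval : φ v / φ (par v) = z := by
        rw [div_eq_iff hu, ← h]
        field_simp
      rw [genRatio, if_neg hu, hval]

/-- The ratios of the Green function form any ratio system of decay rate less than one. -/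
theorem CoverOperator.genRatio_green (hC : CoverOperator H T π M m) (hu : IsUnit M)
    {r : (supportGraph H m).Dart → OnePoint ℂ} (hr : IsRatioSystem (supportGraph H m) m r)
    (hd : decayRate (supportGraph H m) m r < 1) {u v w : VT} (hadj : T.Adj u v)
    (huv : (supportGraph H m).Adj (π u) (π v)) (hpath : OnPath T w u v)
    (hne : ¬ (green M w u = 0 ∧ green M w v = 0)) :
    genRatio (green M w v) (green M w u) = r ⟨(π u, π v), huv⟩ := by
  classical
  obtain ⟨P, K, hL⟩ := hC.exists_localRatios hr hd
  have hlt := hpath.dist_lt hC.cover.isTree hadj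
  have hO := isOrientation_treeParent hC.cover (supportGraph H m) w
  have hpar : treeParent T w v = u := treeParent_eq hC.cover.isTree hadj.symm hlt
  have hvD : v ∈ {v | ∃ y ∈ coverNbrs hC.cover (supportGraph H m) v,
      T.dist w y < T.dist w v} := ⟨u, mem_coverNbrs.2 ⟨hadj.symm, huv.symm⟩, hlt⟩
  have hw : ∀ x ∈ {v | ∃ y ∈ coverNbrs hC.cover (supportGraph H m) v,
      T.dist w y < T.dist w v}, M (greenRow M w) x = 0 := by
    rintro x ⟨y, -, hy⟩
    rw [apply_greenRow hu]
    refine delta_of_ne ?_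
    rintro rfl
    simp at hy
  obtain ⟨B, -, hB⟩ := hL.sqBound_residual hO
  -- The source `w` has no parent, so the right-hand side vanishes on all vertices with one; the
  -- bound with `C = 0` annihilates every residual.
  have hzero := hB (greenRow M w) (M (greenRow M w)) 0 (summable_norm_sq _)
    (sqBound_of_sum_le fun s => by
      refine (Finset.sum_eq_zero fun x _ => ?_).le
      split_ifs with hx
      · rw [hw x hx]; simp
      · simp)
    (fun x _ => hC.apply_eq _ x)
  have hres := hzero.sum_le {v}
  rw [Finset.sum_singleton, if_pos hvD, mul_zero] at hres
  have hres0 : residual (coverRatio π r) (treeParent T w) (greenRow M w) v = 0 :=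
    norm_eq_zero.1 (pow_eq_zero_iff two_ne_zero |>.1 (le_antisymm hres (sq_nonneg _)))
  rw [green_eq hC.symmetric hu, green_eq hC.symmetric hu] at hne ⊢
  have := genRatio_eq_of_residual hres0 (by rwa [hpar])
  rw [hpar] at this
  rw [this, coverRatio, extendDart_of_adj huv]

end GreenRatios

/-! ### Orientations towards the ends -/

section Cycles

variable {V : Type*} {G : SimpleGraph V}

/-- Following a cycle. -/
lemma exists_next_of_isCycle {b : V} {p : G.Walk b b} (hp : p.IsCycle) :
    ∃ next : V → V, ∀ a ∈ p.support,
      next a ∈ p.support ∧ G.Adj a (next a) ∧ next (next a) ≠ a := by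
  classical
  -- Length at least three makes the indices `i` and `i + 2` distinct modulo the length, which
  -- excludes backtracking.
  have hlen := hp.three_le_length
  have hidx : ∀ a ∈ p.support, ∃ i, i < p.length ∧ p.getVert i = a := by
    intro a ha
    obtain ⟨i, hi, hi'⟩ := SimpleGraph.Walk.mem_support_iff_exists_getVert.1 ha
    rcases hi'.lt_or_eq with h | h
    · exact ⟨i, h, hi⟩
    · refine ⟨0, by omega, ?_⟩
      rw [← hi, h, p.getVert_zero, p.getVert_length]
  have hinj : ∀ i j, i < p.length → j < p.length → p.getVert i = p.getVert j → i = j :=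
    fun i j hi hj h => hp.getVert_injOn' (by rw [Set.mem_ofPred_eq]; omega)
      (by rw [Set.mem_ofPred_eq]; omega) h
  obtain ⟨F, hF⟩ : ∃ F : V → V, ∀ i, i < p.length → F (p.getVert i) = p.getVert (i + 1) := by
    refine ⟨fun a => if h : a ∈ p.support then p.getVert ((hidx a h).choose + 1) else a,
      fun i hi => ?_⟩
    have hmem := p.getVert_mem_support i
    simp only [dif_pos hmem]
    have hs := (hidx _ hmem).choose_spec
    rw [hinj _ _ hs.1 hi hs.2]
  refine ⟨F, fun a ha => ?_⟩
  obtain ⟨i, hi, rfl⟩ := hidx a ha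
  rw [hF i hi]
  refine ⟨p.getVert_mem_support _, p.adj_getVert_succ hi, ?_⟩
  have hend : p.getVert p.length = p.getVert 0 := by rw [p.getVert_length, p.getVert_zero]
  rcases Nat.lt_or_ge (i + 1) p.length with h | h
  · rw [hF _ h]
    rcases Nat.lt_or_ge (i + 2) p.length with h' | h'
    · exact fun heq => absurd (hinj _ _ h' hi heq) (by omega)
    · have h2 : i + 1 + 1 = p.length := by omega
      rw [h2, hend]
      exact fun heq => absurd (hinj _ _ (by omega) hi heq) (by omega)
  · have h2 : i + 1 = p.length := by omega
    rw [h2, hend, hF 0 (by omega)]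
    exact fun heq => absurd (hinj _ _ (by omega) hi heq) (by omega)

lemma exists_adj_dist_lt {a c : V} (hr : G.Reachable a c) (ha : a ≠ c) :
    ∃ y, G.Adj a y ∧ G.dist y c < G.dist a c := by
  obtain ⟨q, hq⟩ := hr.exists_walk_length_eq_dist
  cases q with
  | nil => exact absurd rfl ha
  | cons hadj q' =>
    refine ⟨_, hadj, ?_⟩
    have := SimpleGraph.dist_le q'
    rw [SimpleGraph.Walk.length_cons] at hq
    omega

/-- If every component contains a cycle, then there is a map moving every vertex to a neighbour
without ever backtracking. -/
lemma exists_nonbacktracking_map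
    (h : ∀ a : V, ∃ b : V, G.Reachable a b ∧ ∃ p : G.Walk b b, p.IsCycle) :
    ∃ f : V → V, ∀ a, G.Adj a (f a) ∧ f (f a) ≠ a := by
  classical
  have h' : ∀ c : G.ConnectedComponent, ∃ b : V, G.connectedComponentMk b = c ∧
      ∃ p : G.Walk b b, p.IsCycle := by
    intro c
    induction c using SimpleGraph.ConnectedComponent.ind with
    | h a =>
      obtain ⟨b, hab, hb⟩ := h a
      exact ⟨b, SimpleGraph.ConnectedComponent.sound hab.symm, hb⟩
  choose b hb p hp using h'
  choose next hnext using fun c => exists_next_of_isCycle (hp c)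
  set comp : V → G.ConnectedComponent := G.connectedComponentMk with hcomp
  have hadjc : ∀ {x y}, G.Adj x y → comp x = comp y := fun hxy =>
    SimpleGraph.ConnectedComponent.sound hxy.reachable
  have hstep : ∀ a, a ≠ b (comp a) →
      ∃ y, G.Adj a y ∧ G.dist y (b (comp a)) < G.dist a (b (comp a)) := fun a =>
    exists_adj_dist_lt (SimpleGraph.ConnectedComponent.exact (hb (comp a)).symm)
  -- On the chosen cycle of the component, go around; elsewhere, step closer to its base point. Off
  -- the cycle the distance drops, and the cycle is never left, so no step is undone. The last
  -- branch never occurs, as the base point lies on the cycle.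
  set f : V → V := fun a => if ha : a ∈ (p (comp a)).support then next (comp a) a
    else if hne : a ≠ b (comp a) then (hstep a hne).choose else a with hf
  have hne_of : ∀ a, a ∉ (p (comp a)).support → a ≠ b (comp a) := by
    have hstart : ∀ c x, x = b c → x ∈ (p c).support := by
      rintro c _ rfl
      exact (p c).start_mem_support
    exact fun a ha heq => ha (hstart _ _ heq)
  have hfin : ∀ a, a ∈ (p (comp a)).support → f a = next (comp a) a := fun a ha => by
    simp only [hf, dif_pos ha]
  have hfout : ∀ a, a ∉ (p (comp a)).support →
      G.Adj a (f a) ∧ G.dist (f a) (b (comp a)) < G.dist a (b (comp a)) := fun a ha => by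
    simp only [hf, dif_neg ha, dif_pos (hne_of a ha)]
    exact (hstep a (hne_of a ha)).choose_spec
  refine ⟨f, fun a => ?_⟩
  by_cases ha : a ∈ (p (comp a)).support
  · obtain ⟨h1, h2, h3⟩ := hnext (comp a) a ha
    rw [hfin a ha]
    refine ⟨h2, ?_⟩
    rw [hfin _ (by rwa [← hadjc h2]), ← hadjc h2]
    exact h3
  · obtain ⟨h1, h2⟩ := hfout a ha
    refine ⟨h1, fun heq => ?_⟩
    have hc := hadjc h1
    by_cases hfa : f a ∈ (p (comp (f a))).support
    · have h3 := (hnext _ _ hfa).1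
      rw [← hfin _ hfa, heq, ← hc] at h3
      exact ha h3
    · have h3 := (hfout _ hfa).2
      rw [heq, ← hc] at h3
      omega

end Cycles

/-! ### An orientation without roots, and invertibility -/

section Ends

variable {VH VT : Type*} [Fintype VH] {H : SimpleGraph VH} {T : SimpleGraph VT} {π : VT → VH}
  {M : L2 VT →L[ℂ] L2 VT} {m : VH → VH → ℂ}

/-- The vertices of the rays that start at the highest vertices of the components and follow the
non-backtracking map `g`. -/
inductive OnRay (top : VT → Prop) (g : VT → VT) : VT → Prop
  | start {t : VT} (h : top t) : OnRay top g t
  | step {x : VT} (h : OnRay top g x) : OnRay top g (g x)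

/-- If every component of `X` contains a cycle, then its lift to the universal cover has an
orientation in which every vertex has a parent. -/
theorem exists_orientation_univ (hπ : IsUniversalCover H T π) {X : SimpleGraph VH} (hX : X ≤ H)
    (hcyc : ∀ a, ∃ b, X.Reachable a b ∧ ∃ p : X.Walk b b, p.IsCycle) :
    ∃ par, IsOrientation (coverNbrs hπ X) Set.univ par := by
  classical
  obtain ⟨f, hf⟩ := exists_nonbacktracking_map hcyc
  obtain ⟨o⟩ := hπ.isTree.connected.nonempty
  choose g hgadj hgπ using fun x => hπ.exists_lift (hX (hf (π x)).1)
  have hgnb : ∀ x, g x ∈ coverNbrs hπ X x := fun x =>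
    mem_coverNbrs.2 ⟨hgadj x, by rw [hgπ]; exact (hf _).1⟩
  have hgg : ∀ x, g (g x) ≠ x := fun x h => (hf (π x)).2 (by rw [← hgπ x, ← hgπ (g x), h])
  set q := treeParent T o with hq
  set top : VT → Prop := fun t => ∀ y ∈ coverNbrs hπ X t, ¬ T.dist o y < T.dist o t with htop
  have hq_eq : ∀ {x y}, y ∈ coverNbrs hπ X x → T.dist o y < T.dist o x → q x = y :=
    fun hy hlt => treeParent_eq hπ.isTree (mem_coverNbrs.1 hy).1 hlt
  -- A ray leaves its top vertex away from `o`. Later it cannot turn back: the only neighbour closer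
  -- to `o` is the previous vertex, which `g` avoids.
  have hray : ∀ x, OnRay top g x → T.dist o x < T.dist o (g x) := by
    intro x hx
    cases hx with
    | start h =>
      exact (dist_lt_or_lt hπ.isTree o (hgadj x)).resolve_right (h _ (hgnb x))
    | @step y hy =>
      have ih : T.dist o y < T.dist o (g y) := by
        induction hy with
        | start h =>
          exact (dist_lt_or_lt hπ.isTree o (hgadj _)).resolve_right (h _ (hgnb _))
        | @step z _ ih =>
          refine (dist_lt_or_lt hπ.isTree o (hgadj _)).resolve_right fun hlt => ?_
          exact hgg z (eq_of_dist_lt hπ.isTree (hgadj _) hlt (hgadj z).symm ih)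
      refine (dist_lt_or_lt hπ.isTree o (hgadj _)).resolve_right fun hlt => ?_
      exact hgg y (eq_of_dist_lt hπ.isTree (hgadj _) hlt (hgadj y).symm ih)
  -- With parents taken towards `o`, exactly the top vertices lack one. Reversing the orientation
  -- along a ray from each of them pushes the defect to infinity.
  set par : VT → VT := fun x => if OnRay top g x then g x else q x with hpar
  have hpar_on : ∀ {x}, OnRay top g x → par x = g x := fun hx => if_pos hx
  have hpar_off : ∀ {x}, ¬ OnRay top g x → par x = q x := fun hx => if_neg hx
  -- the parent in the rooted tree of a vertex on a ray is the previous vertex of the ray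
  have hprev : ∀ {x y}, OnRay top g y → y ∈ coverNbrs hπ X x → T.dist o x < T.dist o y →
      OnRay top g x ∧ g x = y := by
    intro x y hy hyx hlt
    cases hy with
    | start h => exact absurd hlt (h x (coverNbrs_comm.1 hyx))
    | @step z hz =>
      have : x = z := eq_of_dist_lt hπ.isTree (mem_coverNbrs.1 hyx).1.symm hlt
        (hgadj z).symm (hray z hz)
      exact ⟨this ▸ hz, by rw [this]⟩
  have hcov : ∀ {x y}, y ∈ coverNbrs hπ X x → T.dist o x < T.dist o y →
      par y = x ∨ par x = y := by
    intro x y hy hlt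
    by_cases hyr : OnRay top g y
    · obtain ⟨h1, h2⟩ := hprev hyr hy hlt
      right
      rw [hpar_on h1, h2]
    · left
      rw [hpar_off hyr]
      exact hq_eq (coverNbrs_comm.1 hy) hlt
  have hoff : ∀ x, ¬ OnRay top g x →
      q x ∈ coverNbrs hπ X x ∧ T.dist o (q x) < T.dist o x := by
    intro x hx
    have : ¬ top x := fun h => hx (OnRay.start h)
    simp only [htop, not_forall, not_not] at this
    obtain ⟨y, hy, hlt⟩ := this
    rw [hq_eq hy hlt]
    exact ⟨hy, hlt⟩
  refine ⟨par, fun {v} _ => ?_, fun {x y} hy => ?_, fun {v} _ _ heq => ?_⟩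
  · by_cases hv : OnRay top g v
    · rw [hpar_on hv]; exact hgnb v
    · rw [hpar_off hv]; exact (hoff v hv).1
  · rcases dist_lt_or_lt hπ.isTree o (mem_coverNbrs.1 hy).1 with h | h
    · rcases hcov hy h with h1 | h1
      · exact Or.inl ⟨Set.mem_univ _, h1⟩
      · exact Or.inr ⟨Set.mem_univ _, h1⟩
    · rcases hcov (coverNbrs_comm.1 hy) h with h1 | h1
      · exact Or.inr ⟨Set.mem_univ _, h1⟩
      · exact Or.inl ⟨Set.mem_univ _, h1⟩
  · by_cases hv : OnRay top g v
    · rw [hpar_on hv, hpar_on (OnRay.step hv)] at heq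
      exact hgg v heq
    · rw [hpar_off hv] at heq
      obtain ⟨h1, h2⟩ := hoff v hv
      by_cases hqv : OnRay top g (q v)
      · rw [hpar_on hqv] at heq
        exact hv (heq ▸ OnRay.step hqv)
      · rw [hpar_off hqv] at heq
        have h3 := (hoff _ hqv).2
        rw [heq] at h3
        omega

/-- A ratio system of decay rate less than one forces invertibility if every component of the
support graph contains a cycle. -/
theorem CoverOperator.isUnit_of_ratioSystem (hC : CoverOperator H T π M m)
    (hcyc : ∀ a, ∃ b, (supportGraph H m).Reachable a b ∧
      ∃ p : (supportGraph H m).Walk b b, p.IsCycle)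
    {r : (supportGraph H m).Dart → OnePoint ℂ} (hr : IsRatioSystem (supportGraph H m) m r)
    (hd : decayRate (supportGraph H m) m r < 1) : IsUnit M := by
  classical
  obtain ⟨P, K, hL⟩ := hC.exists_localRatios hr hd
  obtain ⟨par, hO⟩ := exists_orientation_univ hC.cover supportGraph_le hcyc
  have := hC.cover.isTree.connected.nonempty
  obtain ⟨B, hB⟩ := hL.sqBound_of_eq hO
  refine hC.symmetric.isUnit_of_bound (B := B) fun f => ?_
  have h := hB f (M f) (‖M f‖ ^ 2) (summable_norm_sq f)
    ⟨summable_norm_sq _, (norm_sq_eq_tsum _).ge⟩ (hC.apply_eq f)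
  rw [norm_sq_eq_tsum f]
  exact h.2

end Ends

/-! ### Deck transformations -/

section Deck

variable {VH VT : Type*} {H : SimpleGraph VH} {T : SimpleGraph VT} {π : VT → VH}

open Classical in
/-- The neighbour of `z` above `b`. -/
noncomputable def liftStep (T : SimpleGraph VT) (π : VT → VH) (z : VT) (b : VH) : VT :=
  if h : ∃ y, T.Adj z y ∧ π y = b then h.choose else z

lemma IsUniversalCover.liftStep_spec (hπ : IsUniversalCover H T π) {z : VT} {b : VH}
    (h : H.Adj (π z) b) : T.Adj z (liftStep T π z b) ∧ π (liftStep T π z b) = b := by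
  rw [liftStep, dif_pos (hπ.exists_lift h)]
  exact (hπ.exists_lift h).choose_spec

open Classical in
/-- The deck transformation sending `o` to `o'`, by recursion on the distance from `o`. -/
noncomputable def deckMap (T : SimpleGraph VT) (π : VT → VH) (o o' : VT) (x : VT) : VT :=
  if h : ∃ y, T.Adj x y ∧ T.dist o y < T.dist o x then
    liftStep T π (deckMap T π o o' h.choose) (π x)
  else o'
termination_by T.dist o x
decreasing_by exact h.choose_spec.2

lemma deckMap_root (o o' : VT) : deckMap T π o o' o = o' := by
  rw [deckMap, dif_neg]
  simp

lemma deckMap_step (hT : T.IsTree) {o o' x y : VT} (hxy : T.Adj x y)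
    (hlt : T.dist o y < T.dist o x) :
    deckMap T π o o' x = liftStep T π (deckMap T π o o' y) (π x) := by
  have h : ∃ y, T.Adj x y ∧ T.dist o y < T.dist o x := ⟨y, hxy, hlt⟩
  rw [deckMap, dif_pos h,
    eq_of_dist_lt hT h.choose_spec.1 h.choose_spec.2 hxy hlt]

/-- Induction from the root of a tree. -/
lemma tree_induction (hT : T.IsTree) (o : VT) {p : VT → Prop} (h0 : p o)
    (hstep : ∀ x y, T.Adj x y → T.dist o y < T.dist o x → p y → p x) (x : VT) : p x := by
  induction hn : T.dist o x using Nat.strong_induction_on generalizing x with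
  | _ n ih =>
    by_cases hx : x = o
    · rwa [hx]
    · obtain ⟨y, hy, hlt⟩ := exists_adj_dist_lt (hT.connected.preconnected x o) hx
      rw [T.dist_comm, T.dist_comm (u := x)] at hlt
      exact hstep x y hy hlt (ih _ (hn ▸ hlt) y rfl)

lemma IsUniversalCover.map_deckMap (hπ : IsUniversalCover H T π) {o o' : VT} (h : π o = π o')
    (x : VT) : π (deckMap T π o o' x) = π x := by
  refine tree_induction (p := fun x => π (deckMap T π o o' x) = π x) hπ.isTree o ?_
    (fun x y hxy hlt ih => ?_) x
  · rw [deckMap_root, h]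
  · rw [deckMap_step hπ.isTree hxy hlt]
    exact (hπ.liftStep_spec (by rw [ih]; exact hπ.adj_map hxy.symm)).2

lemma IsUniversalCover.adj_deckMap (hπ : IsUniversalCover H T π) {o o' : VT} (h : π o = π o')
    {x y : VT} (hxy : T.Adj x y) : T.Adj (deckMap T π o o' x) (deckMap T π o o' y) := by
  have key : ∀ {x y : VT}, T.Adj x y → T.dist o y < T.dist o x →
      T.Adj (deckMap T π o o' x) (deckMap T π o o' y) := by
    intro x y hxy hlt
    rw [deckMap_step hπ.isTree hxy hlt]
    refine (hπ.liftStep_spec ?_).1.symm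
    rw [hπ.map_deckMap h]
    exact hπ.adj_map hxy.symm
  rcases dist_lt_or_lt hπ.isTree o hxy with hlt | hlt
  · exact (key hxy.symm hlt).symm
  · exact key hxy hlt

/-- Lifts of a step are unique: if the composite fixes `y`, it sends a neighbour `x` of `y` to a
neighbour of `y` above the same vertex, which is `x`. -/
lemma IsUniversalCover.deckMap_deckMap (hπ : IsUniversalCover H T π) {o o' : VT} (h : π o = π o')
    (x : VT) : deckMap T π o' o (deckMap T π o o' x) = x := by
  refine tree_induction (p := fun x => deckMap T π o' o (deckMap T π o o' x) = x) hπ.isTree o ?_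
    (fun x y hxy _ ih => ?_) x
  · rw [deckMap_root, deckMap_root]
  · have h1 := hπ.adj_deckMap h.symm (hπ.adj_deckMap h hxy)
    rw [ih] at h1
    refine hπ.lift_unique h1.symm hxy.symm ?_
    rw [hπ.map_deckMap h.symm, hπ.map_deckMap h]

/-- The group of deck transformations acts transitively on the fibres. -/
lemma IsUniversalCover.exists_deck (hπ : IsUniversalCover H T π) {o o' : VT} (h : π o = π o') :
    ∃ γ : VT ≃ VT, γ o = o' ∧ (∀ x, π (γ x) = π x) ∧ ∀ x y, T.Adj (γ x) (γ y) ↔ T.Adj x y := by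
  refine ⟨⟨deckMap T π o o', deckMap T π o' o, hπ.deckMap_deckMap h, hπ.deckMap_deckMap h.symm⟩,
    deckMap_root _ _, hπ.map_deckMap h, fun x y => ⟨fun hxy => ?_, hπ.adj_deckMap h⟩⟩
  have := hπ.adj_deckMap h.symm hxy
  rwa [Equiv.coe_fn_mk, hπ.deckMap_deckMap h, hπ.deckMap_deckMap h] at this

end Deck

/-! ### The two sides of an edge of a tree -/

section Sides

variable {V : Type*} {T : SimpleGraph V}

/-- The vertices on the side of `v` of the edge `uv`. -/
def side (T : SimpleGraph V) (u v : V) : Set V :=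
  {x | (T.deleteEdges {s(u, v)}).Reachable v x}

lemma mem_side_self (u v : V) : v ∈ side T u v := SimpleGraph.Reachable.refl v

lemma not_mem_side (hT : T.IsAcyclic) {u v : V} (h : T.Adj u v) : u ∉ side T u v := fun hu =>
  SimpleGraph.isBridge_iff.1 (SimpleGraph.isAcyclic_iff_forall_adj_isBridge.1 hT h) hu.symm

lemma disjoint_side (hT : T.IsAcyclic) {u v x : V} (h : T.Adj u v) (hx : x ∈ side T u v) :
    x ∉ side T v u := fun hx' => by
  rw [side, Sym2.eq_swap] at hx'
  exact not_mem_side hT h (SimpleGraph.Reachable.trans hx hx'.symm)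

lemma eq_of_mem_side_of_notMem (hT : T.IsAcyclic) {u v x y : V} (huv : T.Adj u v)
    (hx : x ∈ side T u v) (hxy : T.Adj x y) (hy : y ∉ side T u v) : x = v ∧ y = u := by
  have hedge : s(x, y) = s(u, v) := by
    by_contra hne
    refine hy (SimpleGraph.Reachable.trans hx (SimpleGraph.Adj.reachable ?_))
    rw [SimpleGraph.deleteEdges_adj]
    exact ⟨hxy, hne⟩
  rcases Sym2.eq_iff.1 hedge with ⟨h1, h2⟩ | h
  · subst h1
    exact absurd hx (not_mem_side hT huv)
  · exact h

/-- A walk from `y` that avoids the edge `vy` never reaches `v`, so it cannot cross the edge `uv`.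
-/
lemma side_subset (hT : T.IsAcyclic) {u v y : V} (huv : T.Adj u v) (hvy : T.Adj v y)
    (hyu : y ≠ u) : side T v y ⊆ side T u v := by
  intro x hx
  have hmem : ∀ {a b}, a ∈ side T u v → T.Adj a b → ¬ (a = v ∧ b = u) → b ∈ side T u v := by
    intro a b ha hab hne
    by_contra hb
    exact hne (eq_of_mem_side_of_notMem hT huv ha hab hb)
  rw [side, Set.mem_ofPred_eq, SimpleGraph.reachable_iff_reflTransGen] at hx
  induction hx with
  | refl => exact hmem (mem_side_self u v) hvy fun h => hyu h.2
  | @tail a b ha hab ih =>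
    have ha' : a ∈ side T v y := (SimpleGraph.reachable_iff_reflTransGen _ _).2 ha
    rw [SimpleGraph.deleteEdges_adj] at hab
    refine hmem ih hab.1 fun h => ?_
    rw [h.1] at ha'
    exact not_mem_side hT hvy ha'

lemma side_disjoint_side (hT : T.IsAcyclic) {v y y' x : V} (hy : T.Adj v y) (hy' : T.Adj v y')
    (hne : y ≠ y') (hx : x ∈ side T v y) : x ∉ side T v y' := fun hx' =>
  disjoint_side hT hy hx (side_subset hT hy.symm hy' hne.symm hx')

lemma map_mem_side {γ : V ≃ V} (hγ : ∀ x y, T.Adj (γ x) (γ y) ↔ T.Adj x y) {u v x : V}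
    (hx : x ∈ side T u v) : γ x ∈ side T (γ u) (γ v) := by
  have hadj : ∀ a b, (T.deleteEdges {s(u, v)}).Adj a b →
      (T.deleteEdges {s(γ u, γ v)}).Adj (γ a) (γ b) := by
    intro a b hab
    rw [SimpleGraph.deleteEdges_adj] at hab ⊢
    refine ⟨(hγ a b).2 hab.1, fun h => hab.2 ?_⟩
    have h' : s(γ a, γ b) = s(γ u, γ v) := h
    simp only [Sym2.eq_iff, γ.injective.eq_iff] at h'
    exact Sym2.eq_iff.2 h'
  exact SimpleGraph.Reachable.map ⟨γ, fun {a b} => hadj a b⟩ hx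

end Sides

/-! ### The rows of the Green function -/

section GreenRows

/-- A square-summable function as an element of `ℓ²(V)`. -/
noncomputable def ofSummable {V : Type*} (f : V → ℂ) (h : Summable fun v => ‖f v‖ ^ 2) : L2 V :=
  ⟨f, memℓp_gen (by simpa using h)⟩

@[simp] lemma ofSummable_apply {V : Type*} (f : V → ℂ) (h : Summable fun v => ‖f v‖ ^ 2) (v : V) :
    ofSummable f h v = f v := rfl

open Classical in
/-- Restriction of a square-summable function to a set. -/
noncomputable def restrict {V : Type*} (S : Set V) (f : L2 V) : L2 V :=
  ofSummable (fun v => if v ∈ S then f v else 0)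
    ((summable_norm_sq f).of_nonneg_of_le (fun _ => sq_nonneg _) fun v => by
      split_ifs
      · exact le_rfl
      · simp)

lemma restrict_of_mem {V : Type*} {S : Set V} {f : L2 V} {x : V} (h : x ∈ S) :
    restrict S f x = f x := by simp [restrict, h]

lemma restrict_of_notMem {V : Type*} {S : Set V} {f : L2 V} {x : V} (h : x ∉ S) :
    restrict S f x = 0 := by simp [restrict, h]

variable {VH VT : Type*} [Fintype VH] {H : SimpleGraph VH} {T : SimpleGraph VT} {π : VT → VH}
  {M : L2 VT →L[ℂ] L2 VT} {m : VH → VH → ℂ}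

lemma eq_greenRow (hu : IsUnit M) {f : L2 VT} {w : VT} (hf : M f = delta w) :
    f = greenRow M w := by
  refine sub_eq_zero.1 (eq_zero_of_isUnit hu ?_)
  rw [map_sub, hf, apply_greenRow hu, sub_self]

/-- The Green function is invariant under deck transformations. -/
lemma CoverOperator.greenRow_deck (hC : CoverOperator H T π M m) (hu : IsUnit M) {γ : VT ≃ VT}
    (hγπ : ∀ x, π (γ x) = π x) (hγ : ∀ x y, T.Adj (γ x) (γ y) ↔ T.Adj x y) (w x : VT) :
    greenRow M (γ w) (γ x) = greenRow M w x := by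
  classical
  set f : L2 VT := ofSummable (fun x => greenRow M (γ w) (γ x))
    ((summable_norm_sq (greenRow M (γ w))).comp_injective γ.injective) with hf
  have hfγ : ∀ x, f x = greenRow M (γ w) (γ x) := fun x => rfl
  suffices f = greenRow M w by rw [← hfγ, this]
  refine eq_greenRow hu ?_
  ext x
  have h1 : M f x = M (greenRow M (γ w)) (γ x) := by
    rw [hC.apply_eq, hC.apply_eq, hγπ, hfγ]
    congr 1
    refine Finset.sum_bij (fun y _ => γ y) (fun y hy => ?_) (fun _ _ _ _ h => γ.injective h)
      (fun y hy => ⟨γ.symm y, ?_, γ.apply_symm_apply y⟩) fun y _ => by rw [hγπ, hfγ]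
    · rw [mem_coverNbrs] at hy ⊢
      rwa [hγ, hγπ, hγπ]
    · rw [mem_coverNbrs] at hy ⊢
      rwa [← hγ, ← hγπ (γ.symm y), γ.apply_symm_apply, ← hγπ x]
  rw [h1, apply_greenRow hu]
  by_cases hx : x = w
  · rw [hx, delta_self, delta_self]
  · rw [delta_of_ne hx, delta_of_ne fun h => hx (γ.injective h)]

/-- Cutting a solution at an edge `uv` where it vanishes at `u`. -/
lemma CoverOperator.apply_restrict_side (hC : CoverOperator H T π M m) {u v : VT}
    (hv : v ∈ coverNbrs hC.cover (supportGraph H m) u) {f : L2 VT} (hfu : f u = 0)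
    (hMf : ∀ x ∈ side T u v, M f x = 0) :
    M (restrict (side T u v) f) = (m (π u) (π v) * f v) • delta u := by
  have hac := hC.cover.isTree.isAcyclic
  have huv := (mem_coverNbrs.1 hv).1
  ext x
  rw [lp.coeFn_smul, Pi.smul_apply, smul_eq_mul]
  by_cases hx : x ∈ side T u v
  · have hxu : x ≠ u := fun h => not_mem_side hac huv (h ▸ hx)
    rw [delta_of_ne hxu, mul_zero, ← hMf x hx, hC.apply_eq, hC.apply_eq, restrict_of_mem hx]
    congr 1
    refine Finset.sum_congr rfl fun y hy => ?_
    by_cases hyS : y ∈ side T u v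
    · rw [restrict_of_mem hyS]
    · rw [restrict_of_notMem hyS,
        (eq_of_mem_side_of_notMem hac huv hx (mem_coverNbrs.1 hy).1 hyS).2, hfu]
  · rw [hC.apply_eq, restrict_of_notMem hx, mul_zero, zero_add]
    have hterm : ∀ y ∈ coverNbrs hC.cover (supportGraph H m) x, y ∈ side T u v → y = v ∧ x = u :=
      fun y hy hyS => eq_of_mem_side_of_notMem hac huv hyS (mem_coverNbrs.1 hy).1.symm hx
    by_cases hxu : x = u
    · subst hxu
      rw [delta_self, mul_one, Finset.sum_eq_single_of_mem v hv, restrict_of_mem (mem_side_self _ _)]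
      intro y hy hyv
      rw [restrict_of_notMem fun hyS => hyv (hterm y hy hyS).1, mul_zero]
    · rw [delta_of_ne hxu, mul_zero]
      refine Finset.sum_eq_zero fun y hy => ?_
      rw [restrict_of_notMem fun hyS => hxu (hterm y hy hyS).2, mul_zero]

/-- The cut creates a source only at `u`, and an invertible `M` has a unique solution for it. -/
lemma CoverOperator.restrict_side_eq (hC : CoverOperator H T π M m) (hu : IsUnit M) {u v : VT}
    (hv : v ∈ coverNbrs hC.cover (supportGraph H m) u) {f : L2 VT} (hfu : f u = 0)
    (hMf : ∀ x ∈ side T u v, M f x = 0) :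
    restrict (side T u v) f = (m (π u) (π v) * f v) • greenRow M u := by
  refine sub_eq_zero.1 (eq_zero_of_isUnit hu ?_)
  rw [map_sub, map_smul, hC.apply_restrict_side hv hfu hMf, apply_greenRow hu, sub_self]

lemma apply_greenRow_of_mem (hu : IsUnit M) {S : Set VT} {w : VT} (hw : w ∉ S) :
    ∀ x ∈ S, M (greenRow M w) x = 0 := fun x hx => by
  rw [apply_greenRow hu, delta_of_ne]
  rintro rfl
  exact hw hx

/-- The rows of the Green function are proportional across an edge. -/
lemma CoverOperator.greenRow_mul_comm (hC : CoverOperator H T π M m) (hu : IsUnit M) {u v : VT}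
    (hv : v ∈ coverNbrs hC.cover (supportGraph H m) u) {w w' : VT} (hw : w ∉ side T u v)
    (hw' : w' ∉ side T u v) :
    greenRow M w' u * greenRow M w v = greenRow M w u * greenRow M w' v := by
  -- This combination vanishes at `u`, so beyond `u` it is a multiple of `G(u, ·)`. If `φ v ≠ 0`,
  -- the multiple is nonzero, so `G(u, ·)` vanishes outside the side of `v`, in particular at `w`
  -- and `w'`; by symmetry both coefficients of `φ` are then zero.
  set φ : L2 VT := greenRow M w' u • greenRow M w - greenRow M w u • greenRow M w' with hφ
  have hφx : ∀ x, φ x = greenRow M w' u * greenRow M w x - greenRow M w u * greenRow M w' x :=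
    fun x => rfl
  by_contra hne
  have hφv : φ v ≠ 0 := by rwa [hφx, sub_ne_zero]
  have hφu : φ u = 0 := by rw [hφx]; ring
  have hMφ : ∀ x ∈ side T u v, M φ x = 0 := by
    intro x hx
    have h1 : M φ x = greenRow M w' u * M (greenRow M w) x -
        greenRow M w u * M (greenRow M w') x := by
      rw [hφ, map_sub, map_smul, map_smul]
      rfl
    rw [h1, apply_greenRow_of_mem hu hw x hx, apply_greenRow_of_mem hu hw' x hx]
    ring
  have hres := hC.restrict_side_eq hu hv hφu hMφ
  have hc : m (π u) (π v) * φ v ≠ 0 := mul_ne_zero (mem_coverNbrs.1 hv).2.2.1 hφv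
  have hvan : ∀ z, z ∉ side T u v → greenRow M z u = 0 := by
    intro z hz
    have h2 : restrict (side T u v) φ z = m (π u) (π v) * φ v * greenRow M u z := by
      rw [hres]
      rfl
    rw [restrict_of_notMem hz] at h2
    rw [greenRow_comm hC.symmetric hu]
    exact (mul_eq_zero.1 h2.symm).resolve_left hc
  apply hφv
  rw [hφx, hvan w hw, hvan w' hw']
  ring

/-- Otherwise, by symmetry, `G(u, ·)` vanishes outside the side of `v`, and the case `w = u` gives
`G(u, v) = 0`; then `M G(u, ·)` would vanish at `u` instead of being `1`. -/
lemma CoverOperator.exists_greenRow_ne (hC : CoverOperator H T π M m) (hu : IsUnit M) {u v : VT}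
    (hv : v ∈ coverNbrs hC.cover (supportGraph H m) u) :
    ∃ w, w ∉ side T u v ∧ ¬ (greenRow M w u = 0 ∧ greenRow M w v = 0) := by
  have hac := hC.cover.isTree.isAcyclic
  have huv := (mem_coverNbrs.1 hv).1
  by_contra! hcon
  have huS := not_mem_side hac huv
  have hvan : ∀ z, z ∉ side T u v → greenRow M u z = 0 := fun z hz => by
    rw [greenRow_comm hC.symmetric hu]
    exact (hcon z hz).1
  have h1 : M (greenRow M u) u = 1 := by rw [apply_greenRow hu, delta_self]
  rw [hC.apply_eq, hvan u huS, mul_zero, zero_add, Finset.sum_eq_zero] at h1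
  · exact zero_ne_one h1
  · intro y hy
    by_cases hyS : y ∈ side T u v
    · rw [(eq_of_mem_side_of_notMem hac huv hyS (mem_coverNbrs.1 hy).1.symm huS).1,
        (hcon u huS).2, mul_zero]
    · rw [hvan y hyS, mul_zero]

end GreenRows

/-! ### The ratio system of the Green function -/

section GreenRatioSystem

lemma genRatio_eq_zero_iff {b a : ℂ} (h : ¬ (a = 0 ∧ b = 0)) :
    genRatio b a = ((0 : ℂ) : OnePoint ℂ) ↔ b = 0 := by
  rw [genRatio]
  split_ifs with ha
  · exact ⟨fun h1 => absurd h1 infty_ne_zero, fun hb => absurd ⟨ha, hb⟩ h⟩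
  · rw [OnePoint.coe_eq_coe, div_eq_zero_iff]
    exact or_iff_left ha

lemma genRatio_eq_infty_iff {b a : ℂ} : genRatio b a = OnePoint.infty ↔ a = 0 := by
  rw [genRatio]
  split_ifs with ha
  · simp [ha]
  · simp [ha]

lemma genRatio_of_ne {b a : ℂ} (ha : a ≠ 0) : genRatio b a = ((b / a : ℂ) : OnePoint ℂ) := by
  rw [genRatio, if_neg ha]

lemma divRatio_genRatio_mul {b a : ℂ} (c : ℂ) (hb : b ≠ 0) :
    divRatio c (genRatio b a) * b = c * a := by
  rw [genRatio]
  split_ifs with ha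
  · rw [divRatio_infty, zero_mul, ha, mul_zero]
  · rw [divRatio_coe]
    field_simp

lemma genRatio_eq_of_mul_eq {a b a' b' : ℂ} (h : ¬ (a = 0 ∧ b = 0)) (h' : ¬ (a' = 0 ∧ b' = 0))
    (heq : a' * b = a * b') : genRatio b a = genRatio b' a' := by
  by_cases ha : a = 0
  · have hb : b ≠ 0 := fun hb => h ⟨ha, hb⟩
    rw [ha, zero_mul] at heq
    have ha' : a' = 0 := (mul_eq_zero.1 heq).resolve_right hb
    rw [genRatio_eq_infty_iff.2 ha, genRatio_eq_infty_iff.2 ha']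
  · by_cases ha' : a' = 0
    · rw [ha', zero_mul] at heq
      exact absurd ⟨ha', (mul_eq_zero.1 heq.symm).resolve_left ha⟩ h'
    · rw [genRatio_of_ne ha, genRatio_of_ne ha']
      congr 1
      rw [div_eq_div_iff ha ha']
      linear_combination heq

variable {VH VT : Type*} {H : SimpleGraph VH} {T : SimpleGraph VT} {π : VT → VH}
  {M : L2 VT →L[ℂ] L2 VT} {m : VH → VH → ℂ}

/-- `r` consists of the ratios of the Green function along the edges of the cover. -/
def IsGreenRatio (T : SimpleGraph VT) (π : VT → VH) (M : L2 VT →L[ℂ] L2 VT) {X : SimpleGraph VH}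
    (r : X.Dart → OnePoint ℂ) : Prop :=
  ∀ ⦃u v w : VT⦄, T.Adj u v → w ∉ side T u v →
    ¬ (greenRow M w u = 0 ∧ greenRow M w v = 0) → ∀ h : X.Adj (π u) (π v),
      r ⟨(π u, π v), h⟩ = genRatio (greenRow M w v) (greenRow M w u)

lemma exists_lift_dart (hH : H.Connected) (hπ : IsUniversalCover H T π) {X : SimpleGraph VH}
    (hX : X ≤ H) (e : X.Dart) : ∃ u v, T.Adj u v ∧ ∃ h : X.Adj (π u) (π v),
      e = ⟨(π u, π v), h⟩ := by
  obtain ⟨u, hu⟩ := hπ.surjective hH e.fst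
  have hadj : X.Adj (π u) e.snd := hu ▸ e.adj
  obtain ⟨v, huv, hv⟩ := hπ.exists_lift (hX hadj)
  exact ⟨u, v, huv, hv.symm ▸ hadj, SimpleGraph.Dart.ext _ _ (Prod.ext hu.symm hv.symm)⟩

/-- The ratio is read off from one lift and one row. A deck transformation moves it to any other
lift, and proportionality of the rows moves it to any other source behind the edge. -/
theorem CoverOperator.exists_isGreenRatio [Fintype VH] (hC : CoverOperator H T π M m) (hu : IsUnit M) :
    ∃ r : (supportGraph H m).Dart → OnePoint ℂ, IsGreenRatio T π M r := by
  have hch : ∀ e : (supportGraph H m).Dart, ∃ u v w, T.Adj u v ∧ π u = e.fst ∧ π v = e.snd ∧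
      w ∉ side T u v ∧ ¬ (greenRow M w u = 0 ∧ greenRow M w v = 0) := by
    intro e
    obtain ⟨u, v, huv, h, rfl⟩ := exists_lift_dart hC.connected hC.cover supportGraph_le e
    obtain ⟨w, hw, hne⟩ := hC.exists_greenRow_ne hu (mem_coverNbrs.2 ⟨huv, h⟩)
    exact ⟨u, v, w, huv, rfl, rfl, hw, hne⟩
  choose U V W hadj hU hV hW hne using hch
  refine ⟨fun e => genRatio (greenRow M (W e) (V e)) (greenRow M (W e) (U e)),
    fun u v w huv hw hnz h => ?_⟩
  set e : (supportGraph H m).Dart := ⟨(π u, π v), h⟩ with he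
  obtain ⟨γ, hγU, hγπ, hγ⟩ := hC.cover.exists_deck (o := U e) (o' := u) (hU e)
  have hγV : γ (V e) = v := by
    refine hC.cover.lift_unique (x := u) ?_ huv ?_
    · rw [← hγU, hγ]
      exact hadj e
    · rw [hγπ, hV]
  have h1 : greenRow M (γ (W e)) u = greenRow M (W e) (U e) := by
    rw [← hγU, hC.greenRow_deck hu hγπ hγ]
  have h2 : greenRow M (γ (W e)) v = greenRow M (W e) (V e) := by
    rw [← hγV, hC.greenRow_deck hu hγπ hγ]
  have hγW : γ (W e) ∉ side T u v := by
    intro hmem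
    have hγ' : ∀ x y, T.Adj (γ.symm x) (γ.symm y) ↔ T.Adj x y := fun x y => by
      rw [← hγ, γ.apply_symm_apply, γ.apply_symm_apply]
    have h3 := map_mem_side hγ' hmem
    rw [γ.symm_apply_apply, ← hγU, ← hγV, γ.symm_apply_apply, γ.symm_apply_apply] at h3
    exact hW e h3
  refine genRatio_eq_of_mul_eq (hne e) hnz ?_
  rw [← h1, ← h2]
  exact hC.greenRow_mul_comm hu (mem_coverNbrs.2 ⟨huv, h⟩) hγW hw

variable {r : (supportGraph H m).Dart → OnePoint ℂ}

/-- The equation `M G(w, ·) = 0` at the head of an edge pointing away from `w`. -/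
lemma CoverOperator.greenRow_eq_zero [Finite VH] [DecidableEq VT] (hC : CoverOperator H T π M m)
    (hu : IsUnit M) {u v w : VT} (hv : v ∈ coverNbrs hC.cover (supportGraph H m) u)
    (hw : w ∉ side T u v) :
    m (π v) (π v) * greenRow M w v + m (π v) (π u) * greenRow M w u +
      ∑ y ∈ (coverNbrs hC.cover (supportGraph H m) v).erase u,
        m (π v) (π y) * greenRow M w y = 0 := by
  have h := apply_greenRow_of_mem hu hw v (mem_side_self u v)
  rw [hC.apply_eq, ← Finset.add_sum_erase _ _ (coverNbrs_comm.1 hv)] at h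
  rw [← h]
  ring

lemma IsGreenRatio.eq_zero_iff (hr : IsGreenRatio T π M r) {u v w : VT} (huv : T.Adj u v)
    (h : (supportGraph H m).Adj (π u) (π v)) (hw : w ∉ side T u v)
    (hne : ¬ (greenRow M w u = 0 ∧ greenRow M w v = 0)) :
    r ⟨(π u, π v), h⟩ = ((0 : ℂ) : OnePoint ℂ) ↔ greenRow M w v = 0 := by
  rw [hr huv hw hne h, genRatio_eq_zero_iff hne]

lemma IsGreenRatio.eq_infty_iff (hr : IsGreenRatio T π M r) {u v w : VT} (huv : T.Adj u v)
    (h : (supportGraph H m).Adj (π u) (π v)) (hw : w ∉ side T u v)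
    (hne : ¬ (greenRow M w u = 0 ∧ greenRow M w v = 0)) :
    r ⟨(π u, π v), h⟩ = OnePoint.infty ↔ greenRow M w u = 0 := by
  rw [hr huv hw hne h, genRatio_eq_infty_iff]

lemma notMem_side_of_ne (hT : T.IsAcyclic) {u v y w : VT} (huv : T.Adj u v) (hvy : T.Adj v y)
    (hyu : y ≠ u) (hw : w ∉ side T u v) : w ∉ side T v y :=
  fun h => hw (side_subset hT huv hvy hyu h)

/-- If `G(w, v) ≠ 0`, the equation at the head `v` divided by it is the recursion, and all ratios
leaving `v` other than towards `u` are finite. If `G(w, v) = 0`, the equation forces a further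
neighbour with nonzero value. -/
theorem CoverOperator.isRatioSystem [Fintype VH] (hC : CoverOperator H T π M m) (hu : IsUnit M)
    (hr : IsGreenRatio T π M r) : IsRatioSystem (supportGraph H m) m r := by
  classical
  have hac := hC.cover.isTree.isAcyclic
  -- every directed edge lifts, together with a row of the Green function not vanishing on it
  have hlift : ∀ e : (supportGraph H m).Dart, ∃ u v w, ∃ (huv : T.Adj u v)
      (h : (supportGraph H m).Adj (π u) (π v)), e = ⟨(π u, π v), h⟩ ∧ w ∉ side T u v ∧
        ¬ (greenRow M w u = 0 ∧ greenRow M w v = 0) := by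
    intro e
    obtain ⟨u, v, huv, h, rfl⟩ := exists_lift_dart hC.connected hC.cover supportGraph_le e
    obtain ⟨w, hw, hne⟩ := hC.exists_greenRow_ne hu (mem_coverNbrs.2 ⟨huv, h⟩)
    exact ⟨u, v, w, huv, h, rfl, hw, hne⟩
  refine ⟨fun e he => ?_, fun e he => ?_, fun e f hf hef => ?_, fun e f hf hef => ?_⟩
  · obtain ⟨u, v, w, huv, h, rfl, hw, hne⟩ := hlift e
    have hgv : greenRow M w v ≠ 0 := fun h0 => he ((hr.eq_zero_iff huv h hw hne).2 h0)
    rw [sum_follows (G' := fun y => m (π v) (π y) * (greenRow M w y / greenRow M w v)) hC.cover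
      supportGraph_le huv h _ fun y hy hyn hyu => ?_]
    · have h1 := hC.greenRow_eq_zero hu (mem_coverNbrs.2 ⟨huv, h⟩) hw
      have h2 := divRatio_genRatio_mul (a := greenRow M w u) (m (π v) (π u)) hgv
      rw [hr huv hw hne h]
      refine mul_right_cancel₀ hgv ?_
      rw [zero_mul, add_mul, add_mul, h2, Finset.sum_mul, ← h1]
      congr 1
      refine Finset.sum_congr rfl fun y _ => ?_
      rw [mul_assoc, div_mul_cancel₀ _ hgv]
    · have hvy := (mem_coverNbrs.1 hyn).1
      rw [hr hvy (notMem_side_of_ne hac huv hvy hyu hw) (fun h0 => hgv h0.1), genRatio_of_ne hgv,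
        finVal_coe]
  · obtain ⟨u, v, w, huv, h, rfl, hw, hne⟩ := hlift e
    have hgv : greenRow M w v = 0 := (hr.eq_zero_iff huv h hw hne).1 he
    have hgu : greenRow M w u ≠ 0 := fun h0 => hne ⟨h0, hgv⟩
    have h1 := hC.greenRow_eq_zero hu (mem_coverNbrs.2 ⟨huv, h⟩) hw
    rw [hgv, mul_zero, zero_add] at h1
    obtain ⟨y, hy, hy0⟩ : ∃ y ∈ (coverNbrs hC.cover (supportGraph H m) v).erase u,
        greenRow M w y ≠ 0 := by
      by_contra! hcon
      rw [Finset.sum_eq_zero fun y hy => by rw [hcon y hy, mul_zero], add_zero] at h1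
      exact (mul_ne_zero h.2.2 hgu) h1
    obtain ⟨hyu, hyn⟩ := Finset.mem_erase.1 hy
    have hvy := (mem_coverNbrs.1 hyn).1
    refine ⟨⟨(π v, π y), (mem_coverNbrs.1 hyn).2⟩,
      (follows_iff hC.cover supportGraph_le huv h _).2 ⟨y, hyn, hyu, rfl, rfl⟩, ?_⟩
    exact (hr.eq_infty_iff hvy _ (notMem_side_of_ne hac huv hvy hyu hw) fun h0 => hy0 h0.2).2 hgv
  · obtain ⟨u, v, w, huv, h, rfl, hw, hne⟩ := hlift e
    obtain ⟨y, hyn, hyu, h1, h2⟩ := (follows_iff hC.cover supportGraph_le huv h f).1 hef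
    have hvy := (mem_coverNbrs.1 hyn).1
    have hf' : f = ⟨(π v, π y), (mem_coverNbrs.1 hyn).2⟩ :=
      SimpleGraph.Dart.ext _ _ (Prod.ext h1 h2)
    rw [hf'] at hf
    rw [hr.eq_zero_iff huv h hw hne]
    by_contra hgv
    exact hgv ((hr.eq_infty_iff hvy _ (notMem_side_of_ne hac huv hvy hyu hw)
      fun h0 => hgv h0.1).1 hf)
  · obtain ⟨v, y, w, hvy, h, rfl, hw, hne⟩ := hlift f
    intro h0
    have h0' : r ⟨(π y, π v), h.symm⟩ = ((0 : ℂ) : OnePoint ℂ) := h0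
    -- The infinite ratio on `(v, y)` gives `G(z, v) = 0` for `z` on the side of `v`, a zero ratio
    -- on `(y, v)` gives it for `z` on the side of `y`. Together they would make a row of the
    -- inverse vanish.
    have hall : ∀ z, greenRow M v z = 0 := by
      intro z
      rw [greenRow_comm hC.symmetric hu]
      by_cases hz : z ∈ side T v y
      · have hz' := disjoint_side hac hvy hz
        by_contra hgv
        exact hgv ((hr.eq_zero_iff hvy.symm h.symm hz' fun h1 => hgv h1.2).1 h0')
      · by_contra hgv
        exact hgv ((hr.eq_infty_iff hvy h hz fun h1 => hgv h1.1).1 hf)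
    have h2 : greenRow M v = 0 := by
      ext z
      exact hall z
    have h3 := apply_greenRow hu v
    rw [h2, map_zero] at h3
    have h4 := delta_self v
    rw [← h3] at h4
    exact zero_ne_one h4

/-! ### Decay of the Green function -/

open Classical in
/-- The squared norm of `f` on the side of `v` of the edge `uv`. -/
noncomputable def sideMass (T : SimpleGraph VT) (f : L2 VT) (u v : VT) : ℝ :=
  ∑' x, if x ∈ side T u v then ‖f x‖ ^ 2 else 0

open Classical in
lemma summable_sideMass (f : L2 VT) (u v : VT) :
    Summable fun x => if x ∈ side T u v then ‖f x‖ ^ 2 else 0 :=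
  (summable_norm_sq f).of_nonneg_of_le (fun x => by split_ifs <;> positivity) fun x => by
    split_ifs
    · exact le_rfl
    · positivity

lemma sideMass_nonneg (f : L2 VT) (u v : VT) : 0 ≤ sideMass T f u v :=
  tsum_nonneg fun x => by split_ifs <;> positivity

/-- The vertex `v` and the sides beyond its further neighbours are disjoint parts of the side of
`v`. They need not exhaust it, as `s` may omit neighbours. -/
lemma sum_sideMass_le [DecidableEq VT] (hT : T.IsAcyclic) (f : L2 VT) {u v : VT}
    (huv : T.Adj u v) {s : Finset VT} (hs : ∀ y ∈ s, T.Adj v y ∧ y ≠ u) :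
    ‖f v‖ ^ 2 + ∑ y ∈ s, sideMass T f v y ≤ sideMass T f u v := by
  classical
  have h1 : ‖f v‖ ^ 2 = ∑' x, if x = v then ‖f x‖ ^ 2 else 0 := by
    rw [tsum_eq_single v fun x hx => if_neg hx, if_pos rfl]
  have hs1 : Summable fun x => if x = v then ‖f x‖ ^ 2 else 0 :=
    summable_of_ne_finset_zero (s := {v}) fun x hx => if_neg (by simpa using hx)
  have hs2 : Summable fun x => ∑ y ∈ s, if x ∈ side T v y then ‖f x‖ ^ 2 else 0 :=
    summable_sum fun y _ => summable_sideMass f v y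
  simp only [sideMass]
  rw [h1, ← Summable.tsum_finsetSum fun y _ => summable_sideMass f v y, ← hs1.tsum_add hs2]
  refine (hs1.add hs2).tsum_le_tsum (fun x => ?_) (summable_sideMass f u v)
  by_cases hx : x = v
  · subst hx
    rw [if_pos rfl, if_pos (mem_side_self u x), Finset.sum_eq_zero fun y hy =>
      if_neg (not_mem_side hT (hs y hy).1), add_zero]
  · rw [if_neg hx, zero_add]
    by_cases hex : ∃ y ∈ s, x ∈ side T v y
    · obtain ⟨y, hy, hxy⟩ := hex
      rw [Finset.sum_eq_single_of_mem y hy, if_pos hxy,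
        if_pos (side_subset hT huv (hs y hy).1 (hs y hy).2 hxy)]
      intro y' hy' hne
      exact if_neg (side_disjoint_side hT (hs y hy).1 (hs y' hy').1 hne.symm hxy)
    · push Not at hex
      rw [Finset.sum_eq_zero fun y hy => if_neg (hex y hy)]
      split_ifs <;> positivity

/-- The normalized masses of the rows of the Green function beyond the lifts of `e`. -/
def massSet (T : SimpleGraph VT) (π : VT → VH) (M : L2 VT →L[ℂ] L2 VT) (a b : VH) : Set ℝ :=
  {t | ∃ u v w, T.Adj u v ∧ π u = a ∧ π v = b ∧ w ∉ side T u v ∧ greenRow M w v ≠ 0 ∧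
    t = sideMass T (greenRow M w) u v / ‖greenRow M w v‖ ^ 2}

/-- The weight is an infimum of normalized masses over all lifts and rows, so lifts and rows never
have to be compared: any row bounds the weights of the successors from above, and the decay
inequality need only be checked against each mass for `e`. -/
theorem CoverOperator.decayRate_lt_one [Fintype VH] (hC : CoverOperator H T π M m) (hu : IsUnit M)
    (hr : IsGreenRatio T π M r) : decayRate (supportGraph H m) m r < 1 := by
  classical
  have hac := hC.cover.isTree.isAcyclic
  have hsys := hC.isRatioSystem hu hr
  set p : {e : (supportGraph H m).Dart // r e ≠ ((0 : ℂ) : OnePoint ℂ)} → ℝ :=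
    fun e => sInf (massSet T π M e.1.fst e.1.snd) with hp
  have hbdd : ∀ a b, BddBelow (massSet T π M a b) := by
    refine fun a b => ⟨0, ?_⟩
    rintro _ ⟨u, v, w, -, -, -, -, -, rfl⟩
    exact div_nonneg (sideMass_nonneg _ _ _) (sq_nonneg _)
  have hnonempty : ∀ e : {e : (supportGraph H m).Dart // r e ≠ ((0 : ℂ) : OnePoint ℂ)},
      (massSet T π M e.1.fst e.1.snd).Nonempty := by
    rintro ⟨e, he⟩
    obtain ⟨u, v, huv, h, rfl⟩ := exists_lift_dart hC.connected hC.cover supportGraph_le e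
    obtain ⟨w, hw, hne⟩ := hC.exists_greenRow_ne hu (mem_coverNbrs.2 ⟨huv, h⟩)
    exact ⟨_, u, v, w, huv, rfl, rfl, hw,
      fun h0 => he ((hr.eq_zero_iff huv h hw hne).2 h0), rfl⟩
  -- the weight is at most the normalized mass of any row
  have hple : ∀ {u v w : VT}, v ∈ coverNbrs hC.cover (supportGraph H m) u → w ∉ side T u v →
      greenRow M w v ≠ 0 →
      ‖greenRow M w v‖ ^ 2 * extendWeight p (π u) (π v) ≤ sideMass T (greenRow M w) u v := by
    intro u v w hv hw hgv
    have huv := (mem_coverNbrs.1 hv).1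
    have h := (mem_coverNbrs.1 hv).2
    have h0 : r ⟨(π u, π v), h⟩ ≠ ((0 : ℂ) : OnePoint ℂ) := fun h0 =>
      hgv ((hr.eq_zero_iff huv h hw fun h1 => hgv h1.2).1 h0)
    rw [extendWeight, extendDart_of_adj h, dif_pos h0, mul_comm,
      ← le_div_iff₀ (pow_pos (norm_pos_iff.2 hgv) 2)]
    exact csInf_le (hbdd _ _) ⟨u, v, w, huv, rfl, rfl, hw, hgv, rfl⟩
  refine decayRate_lt_one_of_weight (p := p) (fun e => ?_) (fun e => ?_)
  · refine le_csInf (hnonempty e) ?_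
    rintro _ ⟨u, v, w, huv, -, -, -, hgv, rfl⟩
    rw [one_le_div (pow_pos (norm_pos_iff.2 hgv) 2)]
    have := sum_sideMass_le hac (greenRow M w) huv (s := ∅) (by simp)
    simpa using this
  refine le_csInf (hnonempty e) ?_
  obtain ⟨⟨⟨a, b⟩, hab⟩, he⟩ := e
  rintro _ ⟨u, v, w, huv, rfl, rfl, hw, hgv, rfl⟩
  rw [sum_decayMatrix_cover hC.cover r p huv hab he, le_div_iff₀ (pow_pos (norm_pos_iff.2 hgv) 2),
    add_mul, one_mul, Finset.sum_mul]
  refine le_trans (add_le_add le_rfl (Finset.sum_le_sum fun y hy => ?_))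
    (sum_sideMass_le hac (greenRow M w) huv (s := (coverNbrs hC.cover (supportGraph H m) v).erase u)
      fun y hy => ⟨(mem_coverNbrs.1 (Finset.mem_of_mem_erase hy)).1, (Finset.mem_erase.1 hy).1⟩)
  obtain ⟨hyu, hyn⟩ := Finset.mem_erase.1 hy
  have hvy := (mem_coverNbrs.1 hyn).1
  have hvy' := (mem_coverNbrs.1 hyn).2
  have hwy := notMem_side_of_ne hac huv hvy hyu hw
  have hRvy : coverRatio π r v y = ((greenRow M w y / greenRow M w v : ℂ) : OnePoint ℂ) := by
    rw [coverRatio, extendDart_of_adj hvy', hr hvy hwy (fun h0 => hgv h0.1) hvy',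
      genRatio_of_ne hgv]
  -- If the row vanishes at `y`, its mass beyond `y` is estimated through the vertex `x` behind an
  -- infinite ratio, where the equation at `y` fixes `|G(w, x)|` in terms of `|G(w, v)|`. Otherwise
  -- no further ratio leaving `y` is infinite and only the finite term remains.
  by_cases hgy : greenRow M w y = 0
  · rw [hRvy, hgy, zero_div, finVal_coe, norm_zero, zero_pow two_ne_zero, zero_mul, zero_add,
      Finset.sum_mul]
    set s := ((coverNbrs hC.cover (supportGraph H m) y).erase v).filter
      (fun x => coverRatio π r y x = OnePoint.infty) with hs
    have hsmem : ∀ x ∈ s, x ∈ coverNbrs hC.cover (supportGraph H m) y ∧ x ≠ v ∧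
        coverRatio π r y x = OnePoint.infty := by
      intro x hx
      obtain ⟨h1, h2⟩ := Finset.mem_filter.1 hx
      exact ⟨Finset.mem_of_mem_erase h1, (Finset.mem_erase.1 h1).1, h2⟩
    refine le_trans (Finset.sum_le_sum fun x hx => ?_) ((le_add_of_nonneg_left (sq_nonneg _)).trans
      (sum_sideMass_le hac (greenRow M w) hvy (s := s)
        fun x hx => ⟨(mem_coverNbrs.1 (hsmem x hx).1).1, (hsmem x hx).2.1⟩))
    obtain ⟨hxn, hxv, hxinf⟩ := hsmem x hx
    have hyx := (mem_coverNbrs.1 hxn).1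
    have hyx' := (mem_coverNbrs.1 hxn).2
    -- `x` is the only neighbour of `y` besides `v` where the row does not vanish
    have honly : ∀ x' ∈ (coverNbrs hC.cover (supportGraph H m) y).erase v, x' ≠ x →
        greenRow M w x' = 0 := by
      intro x' hx' hne
      obtain ⟨hxv', hxn'⟩ := Finset.mem_erase.1 hx'
      have hyx1 := (mem_coverNbrs.1 hxn').1
      have hyx2 := (mem_coverNbrs.1 hxn').2
      by_contra hg
      have hinf' : r ⟨(π y, π x'), hyx2⟩ = OnePoint.infty :=
        (hr.eq_infty_iff hyx1 hyx2 (notMem_side_of_ne hac hvy hyx1 hxv' hwy)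
          fun h0 => hg h0.2).2 hgy
      rw [coverRatio, extendDart_of_adj hyx'] at hxinf
      have h3 := hsys.symm_ne_zero_of_top ⟨(π x', π y), hyx2.symm⟩ ⟨(π y, π x), hyx'⟩ hxinf
        ((follows_iff hC.cover supportGraph_le hyx1.symm hyx2.symm _).2
          ⟨x, hxn, hne.symm, rfl, rfl⟩)
      exact h3 (hsys.eq_zero_of_top ⟨(π x, π y), hyx'.symm⟩ ⟨(π y, π x'), hyx2⟩ hinf'
        ((follows_iff hC.cover supportGraph_le hyx.symm hyx'.symm _).2
          ⟨x', hxn', hne, rfl, rfl⟩))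
    have heq := hC.greenRow_eq_zero hu hyn hwy
    rw [hgy, mul_zero, zero_add, Finset.sum_eq_single_of_mem x (Finset.mem_erase.2 ⟨hxv, hxn⟩)
      fun x' hx' hne => by rw [honly x' hx' hne, mul_zero]] at heq
    have hmx : m (π y) (π x) ≠ 0 := hyx'.2.1
    have hgx : greenRow M w x = -(m (π y) (π v) / m (π y) (π x) * greenRow M w v) := by
      field_simp
      linear_combination heq
    have hnorm : ‖greenRow M w x‖ ^ 2 =
        ‖m (π y) (π v) / m (π y) (π x)‖ ^ 2 * ‖greenRow M w v‖ ^ 2 := by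
      rw [hgx, norm_neg, norm_mul, mul_pow]
    have hgx0 : greenRow M w x ≠ 0 := by
      rw [hgx]
      exact neg_ne_zero.2 (mul_ne_zero (div_ne_zero hvy'.2.2 hmx) hgv)
    rw [mul_right_comm, ← hnorm]
    exact hple hxn (notMem_side_of_ne hac hvy hyx hxv hwy) hgx0
  · rw [Finset.sum_eq_zero, add_zero, hRvy, finVal_coe, mul_right_comm, ← mul_pow, ← norm_mul,
      div_mul_cancel₀ _ hgv]
    · exact hple hyn hwy hgy
    · intro x hx
      exfalso
      obtain ⟨h1, h2⟩ := Finset.mem_filter.1 hx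
      obtain ⟨hxv, hxn⟩ := Finset.mem_erase.1 h1
      have hyx := (mem_coverNbrs.1 hxn).1
      rw [coverRatio, extendDart_of_adj (mem_coverNbrs.1 hxn).2] at h2
      exact hgy ((hr.eq_infty_iff hyx _ (notMem_side_of_ne hac hvy hyx hxv hwy)
        fun h0 => hgy h0.1).1 h2)

end GreenRatioSystem

end TreeOperator

theorem theorem1p3 {VH VT : Type*} [Fintype VH]
    (H : SimpleGraph VH) (hH : H.Connected)
    (T : SimpleGraph VT) (π : VT → VH) (hπ : TreeOperator.IsUniversalCover H T π)
    (M : TreeOperator.L2 VT →L[ℂ] TreeOperator.L2 VT) (m : VH → VH → ℂ)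
    (hpull : TreeOperator.IsPullback T π M m)
    (hsymm : TreeOperator.IsSymmetric M)
    (hlocal : TreeOperator.IsLocal T M) :
    -- if `M` has a bounded inverse, then it has a ratio system of decay rate less than one
    (IsUnit M →
      ∃ r : (TreeOperator.supportGraph H m).Dart → OnePoint ℂ,
        TreeOperator.IsRatioSystem (TreeOperator.supportGraph H m) m r ∧
        TreeOperator.decayRate (TreeOperator.supportGraph H m) m r < 1) ∧
    -- the converse, when every connected component of `H_M` contains a cycle
    ((∀ a : VH, ∃ b : VH, (TreeOperator.supportGraph H m).Reachable a b ∧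
        ∃ p : (TreeOperator.supportGraph H m).Walk b b, p.IsCycle) →
      (∃ r : (TreeOperator.supportGraph H m).Dart → OnePoint ℂ,
        TreeOperator.IsRatioSystem (TreeOperator.supportGraph H m) m r ∧
        TreeOperator.decayRate (TreeOperator.supportGraph H m) m r < 1) →
      IsUnit M) ∧
    -- the ratios of the Green function
    (IsUnit M →
      ∀ r : (TreeOperator.supportGraph H m).Dart → OnePoint ℂ,
        TreeOperator.IsRatioSystem (TreeOperator.supportGraph H m) m r →
        TreeOperator.decayRate (TreeOperator.supportGraph H m) m r < 1 →
        ∀ u v w : VT, T.Adj u v →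
          ∀ huv : (TreeOperator.supportGraph H m).Adj (π u) (π v),
            TreeOperator.OnPath T w u v →
            ¬ (TreeOperator.green M w u = 0 ∧ TreeOperator.green M w v = 0) →
            TreeOperator.genRatio (TreeOperator.green M w v) (TreeOperator.green M w u) =
              r ⟨(π u, π v), huv⟩) := by
  have hC : TreeOperator.CoverOperator H T π M m := ⟨hH, hπ, hpull, hsymm, hlocal⟩
  refine ⟨fun hu => ?_, ?_, ?_⟩
  · obtain ⟨r, hr⟩ := hC.exists_isGreenRatio hu
    exact ⟨r, hC.isRatioSystem hu hr, hC.decayRate_lt_one hu hr⟩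
  · rintro hcyc ⟨r, hr, hd⟩
    exact hC.isUnit_of_ratioSystem hcyc hr hd
  · intro hu r hr hd u v w hadj huv hpath hne
    exact hC.genRatio_green hu hr hd hadj huv hpath hne
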